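/- Let $K\ge 1$ arms (beam pairs, listed by increasing misalignment) have energy levels $p_k>0$ and success probabilities $\theta=(\theta_1,\dots,\theta_K)\in[0,1]^K$. Playing arm $k$ in a round pays $p_k$ with probability $\theta_k$ and $0$ otherwise, independently of the past; put $\mu_k=p_k\theta_k$. Assume $\theta\in\mathcal T\cap\mathcal U$, i.e. $\theta_1\ge\dots\ge\theta_K$, and for some (unique) $k^*$, $\mu_1<\dots<\mu_{k^*}>\mu_{k^*+1}>\dots>\mu_K$. Let $$N(k)=\{j\in\{k-1,k+1\}: 1\le j\le K,\ \mu_k\le p_j\},\qquad I(x,y)=x\log\tfrac{x}{y}+(1-x)\log\tfrac{1-x}{1-y},$$ with $0\log 0=0$ and $I(x,y)=\infty$ if ($y=0\ne x$) or ($y=1\ne x$). The Unimodal Beam Alignment (UBA) policy with parameter $c>0$ acts as follows. Before round $t$, let $s_k(t)$ be the number of plays of arm $k$ so far and $\hat\mu_k(t)$ its empirical mean reward ($0$ if $s_k(t)=0$). The leader is $L(t)\in\arg\max_k\hat\mu_k(t)$, and $l(t)$ is the number of rounds $n\le t$ with $L(n)=L(t)$. If $(l(t)-1)/3$ is a natural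 number, play $L(t)$. Otherwise play an arm of $A(L(t))$ with the largest index $$b_k(t)=\sup\Big\{q\in[0,p_k]: I\big(\tfrac{\hat\mu_k(t)}{p_k},\tfrac{q}{p_k}\big)\le \tfrac{\log l(t)+c\log\log l(t)}{s_k(t)}\Big\},\qquad b_k(t)=p_k\text{ if }s_k(t)=0,$$ where $A(k)$ is $\{k\}\cup N(k)$, or the set of arms in $\{k-1,k,k+1\}$, or any fixed set in between. Ties are broken arbitrarily (based on the past, possibly at random), and $\sup\emptyset=0$. Let $\mathcal R(T)=\mu_{k^*}T-\sum_k\mathbb E[s_k]\,\mu_k$ be the regret after $T$ rounds, where $s_k$ is the number of plays of arm $k$ in these $T$ rounds. If $p_1\ge p_2\ge\dots\ge p_K$, then for every $\epsilon>0$ there is a constant $C$ such that for all $T\ge1$ $$\mathcal R(T)\le(1+\epsilon)\sum_{k\in N(k^*)}\frac{p_{k^*}\theta_{k^*}-p_k\theta_k}{I(\theta_k,\theta_{k^*})}\,\log T+C,$$ where a term is $+\infty$ if $I=0$ and $0$ if $I=\infty$ (and $\infty\cdot\log 1=0$). Without the monotonicity of $p$, the same holds with $I\big(\theta_k,\tfrac{p_{k^*}\theta_{k^*}}{p_k}\big)$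 in place of $I(\theta_k,\theta_{k^*})$. -/

import Mathlib

open MeasureTheory ProbabilityTheory
open scoped ENNReal NNReal

namespace BeamAlignment

/-- The class `𝒯`: success probabilities `θ₁ ≥ θ₂ ≥ ... ≥ θ_K` in `[0,1]`. -/
def monotoneClass (K : ℕ) : Set (Fin K → ℝ) :=
  {θ | (∀ k, θ k ∈ Set.Icc (0 : ℝ) 1) ∧ Antitone θ}

/-- The class `𝒰`: success probabilities in `[0,1]` for which the mean rewards `p k * θ k` strictly
increase up to some arm `m` and strictly decrease from `m` on. -/
def unimodalClass {K : ℕ} (p : Fin K → ℝ) : Set (Fin K → ℝ) :=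
  {θ | (∀ k, θ k ∈ Set.Icc (0 : ℝ) 1) ∧
    ∃ m : Fin K, StrictMonoOn (fun k => p k * θ k) (Set.Iic m) ∧
      StrictAntiOn (fun k => p k * θ k) (Set.Ici m)}

/-- `j` is one of `k - 1`, `k + 1`. -/
def Adjacent {K : ℕ} (j k : Fin K) : Prop := j.val + 1 = k.val ∨ j.val = k.val + 1

open Classical in
/-- `N(k) = {j ∈ {k-1, k+1} : p_k θ_k ≤ p_j}`. -/
noncomputable def neighbours {K : ℕ} (p θ : Fin K → ℝ) (k : Fin K) : Finset (Fin K) :=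
  Finset.univ.filter fun j => Adjacent j k ∧ p k * θ k ≤ p j

open Classical in
/-- `I(x, y) = x log (x / y) + (1 - x) log ((1 - x) / (1 - y))` for `x, y ∈ [0,1]`, with
`0 log 0 = 0` and the value `∞` if the first law is not absolutely continuous with respect to
the second. -/
noncomputable def bernoulliKL (x y : ℝ) : ℝ≥0∞ :=
  if (y = 0 ∧ x ≠ 0) ∨ (y = 1 ∧ x ≠ 1) then ⊤
  else ENNReal.ofReal (x * Real.log (x / y) + (1 - x) * Real.log ((1 - x) / (1 - y)))

/-! Statistics along one sample path. Rounds are numbered `0, 1, 2, ...`; `arm n` is the arm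
played in round `n`, `lead n` the leader in round `n`, and `x n k` says whether arm `k` would
succeed in round `n`. A decision in round `t` uses the outcomes of the rounds before `t`. -/

/-- The number of times that arm `k` is played in the first `t` rounds. -/
def pulls {K : ℕ} (arm : ℕ → Fin K) (k : Fin K) (t : ℕ) : ℕ :=
  ((Finset.range t).filter fun n => arm n = k).card

/-- The empirical mean reward of arm `k` over the first `t` rounds (`0` if it was not played);
a success of arm `k` pays `p k`. -/
noncomputable def empMean {K : ℕ} (p : Fin K → ℝ) (x : ℕ → Fin K → Bool) (arm : ℕ → Fin K)
    (k : Fin K) (t : ℕ) : ℝ :=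
  if pulls arm k t = 0 then 0
  else (∑ n ∈ Finset.range t, if arm n = k ∧ x n k = true then p k else 0) / (pulls arm k t : ℝ)

/-- The number of rounds, up to and including round `t`, whose leader is the leader of
round `t`. -/
def leadCount {K : ℕ} (lead : ℕ → Fin K) (t : ℕ) : ℕ :=
  ((Finset.range (t + 1)).filter fun n => lead n = lead t).card

/-- `log l + c log log l`. -/
noncomputable def explorationRate (c : ℝ) (l : ℕ) : ℝ :=
  Real.log l + c * Real.log (Real.log l)

/-- The index `sup {q ∈ [0, p_k] : I(μ̂_k / p_k, q / p_k) ≤ f / s_k}` of arm `k` in round `t`; the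
bound `f / s_k` is `+∞` for an arm that has not been played, so that its index is `p_k`. -/
noncomputable def index {K : ℕ} (p : Fin K → ℝ) (c : ℝ) (x : ℕ → Fin K → Bool)
    (lead arm : ℕ → Fin K) (k : Fin K) (t : ℕ) : ℝ :=
  if pulls arm k t = 0 then p k
  else sSup {q : ℝ | q ∈ Set.Icc 0 (p k) ∧
    ((bernoulliKL (empMean p x arm k t / p k) (q / p k) : ℝ≥0∞) : EReal) ≤
      ((explorationRate c (leadCount lead t) / (pulls arm k t : ℝ) : ℝ) : EReal)}

/-- The sequences of leaders and of played arms obey the selection rule of Unimodal Beam Alignment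
along the sample path `x`, with `A k` the set of arms that may be played while `k` leads. The
leader has the largest empirical mean. It is played if `(l - 1) / (γ + 1)` is a natural number,
where `l` counts the rounds that it has led and `γ = 2` is the maximal degree of the line graph on
the arms; otherwise an arm of `A` with the largest index is played. Ties are broken arbitrarily. -/
structure FollowsUBA {K : ℕ} (p : Fin K → ℝ) (c : ℝ) (A : Fin K → Finset (Fin K))
    (x : ℕ → Fin K → Bool) (lead arm : ℕ → Fin K) : Prop where
  leader_max : ∀ t k, empMean p x arm k t ≤ empMean p x arm (lead t) t
  play_leader : ∀ t, (2 + 1) ∣ (leadCount lead t - 1) → arm t = lead t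
  play_index : ∀ t, ¬ (2 + 1) ∣ (leadCount lead t - 1) →
    arm t ∈ A (lead t) ∧
      ∀ j ∈ A (lead t), index p c x lead arm j t ≤ index p c x lead arm (arm t) t

/-- Bernoulli arms: `X t · k` is the success of arm `k` in round `t`, of probability `θ k`. The
σ-algebra `ℱ t` is what is known before round `t` (past outcomes, and possibly random choices); the
outcomes of round `t` are independent of it. Outcomes of different arms in one round may depend on
each other. -/
structure IsBernoulliBandit {Ω : Type*} {m : MeasurableSpace Ω} {K : ℕ} (P : Measure Ω)
    (ℱ : Filtration ℕ m) (θ : Fin K → ℝ) (X : ℕ → Ω → Fin K → Bool) : Prop where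
  adapted : ∀ t, Measurable[ℱ (t + 1)] (X t)
  indep : ∀ t, Indep (MeasurableSpace.comap (X t) inferInstance) (ℱ t) P
  prob : ∀ t k, P.real {ω | X t ω k = true} = θ k

/-- The regret `μ* T - ∑_k E[s_k(T)] p_k θ_k` over the first `T` rounds, where `μ*` is the mean
reward of arm `kstar`. -/
noncomputable def regret {Ω : Type*} [MeasurableSpace Ω] {K : ℕ} (P : Measure Ω)
    (p θ : Fin K → ℝ) (kstar : Fin K) (arm : ℕ → Ω → Fin K) (T : ℕ) : ℝ :=
  p kstar * θ kstar * T -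
    ∑ k, (∫ ω, (pulls (fun n => arm n ω) k T : ℝ) ∂P) * (p k * θ k)

end BeamAlignment

/-! The regret is the sum over arms of the gap times the expected number of plays
(`ofReal_regret_le`). A play of a suboptimal arm happens either while some arm other than `kstar`
leads, or while `kstar` leads.

The first kind is bounded in expectation. By unimodality a suboptimal leader `k` has a strictly
better neighbour `j` in `A k`. Every third lead is a play of the leader, so a long-leading `k` has
an accurate empirical mean. In the other rounds, the arm of largest index is played. If that arm has
many plays, its index is hardly above its empirical mean, hence hardly above that of `k`, so the
index of `j` is below the true mean of `j` by a fixed margin. Otherwise an arm with few plays is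
used up, which can happen only rarely. This dichotomy is the pathwise statement
`FollowsUBA.deviates_of_lt_pulls_lead`. The underestimation of `j` has probability of order `L ^
(-(1 + η))` after `L` leads (`measure_undershoots_le`): the fixed margin improves the exponent
beyond 1, so every `c > 0` is enough. Summing over `L` gives the bound.

For the second kind, only `kstar` and adjacent arms are played. Let `μ` be the mean reward of the
best arm. If `p j < μ`, the index of `j` is capped below `μ`, and `j` is played only when the mean
of `kstar` is off. If `p j > μ`, the usual KL-UCB computation gives `(1 + ε) log T / I` plays. If `p
j = μ`, the divergence is infinite and boundedly many plays must be shown: the mean of `kstar` is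
within order `n ^ (-1 / 4)` of `p j` after `n` plays, which forces a divergence of order `log n`,
more than the exploration term permits once `j` has a fixed number of plays.

All probabilities come from one estimate: the first `n` plays of an arm are dominated by binomial
probabilities, which the method of types bounds by the divergence.

For non-increasing `p`, the neighbour lies after `kstar`, and monotonicity of the divergence in its
second argument replaces `p kstar * θ kstar / p k` by `θ kstar`. -/

namespace BeamAlignment

/-! ### Bernoulli divergence: Hellinger bound, superadditivity, continuity -/

theorem bernoulliKL_self (x : ℝ) : bernoulliKL x x = 0 := by
  unfold bernoulliKL
  rw [if_neg (by tauto)]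
  rcases eq_or_ne x 0 with rfl | h0
  · simp
  rcases eq_or_ne x 1 with rfl | h1
  · simp
  rw [div_self h0, div_self (sub_ne_zero.2 h1.symm)]
  simp

/-- The Bernoulli divergence away from the boundary of the second argument. -/
noncomputable def realKL (x y : ℝ) : ℝ :=
  x * Real.log (x / y) + (1 - x) * Real.log ((1 - x) / (1 - y))

theorem bernoulliKL_of_mem_Ioo {y : ℝ} (hy : y ∈ Set.Ioo (0 : ℝ) 1) (x : ℝ) :
    bernoulliKL x y = ENNReal.ofReal (realKL x y) := by
  unfold bernoulliKL realKL
  rw [if_neg]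
  rintro (⟨h, -⟩ | ⟨h, -⟩)
  · exact hy.1.ne' h
  · exact hy.2.ne h

theorem bernoulliKL_one_right {x : ℝ} (hx : x ≠ 1) : bernoulliKL x 1 = ⊤ := by
  unfold bernoulliKL
  rw [if_pos (Or.inr ⟨rfl, hx⟩)]

theorem bernoulliKL_zero_right {x : ℝ} (hx : x ≠ 0) : bernoulliKL x 0 = ⊤ := by
  unfold bernoulliKL
  rw [if_pos (Or.inl ⟨rfl, hx⟩)]

/-- A lower bound for one summand of the divergence. -/
theorem mul_log_div_ge {x y : ℝ} (hx : 0 ≤ x) (hy : 0 < y) :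
    2 * (x - √x * √y) ≤ x * Real.log (x / y) := by
  rcases hx.eq_or_lt with rfl | hx
  · simp
  have h1 : Real.log (x / y) = -(2 * Real.log (√y / √x)) := by
    rw [Real.log_div hx.ne' hy.ne', Real.log_div (Real.sqrt_pos.2 hy).ne' (Real.sqrt_pos.2 hx).ne',
      Real.log_sqrt hx.le, Real.log_sqrt hy.le]
    ring
  have h2 : Real.log (√y / √x) ≤ √y / √x - 1 :=
    Real.log_le_sub_one_of_pos (div_pos (Real.sqrt_pos.2 hy) (Real.sqrt_pos.2 hx))
  have h3 : x * (√y / √x) = √x * √y := by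
    have := Real.mul_self_sqrt hx.le
    have h0 := (Real.sqrt_pos.2 hx).ne'
    field_simp
    nlinarith
  rw [h1]
  nlinarith [mul_le_mul_of_nonneg_left h2 hx.le]

/-- The right side is `(√x - √y) ^ 2`, and `√x + √y ≤ 2`. Together with `mul_log_div_ge` this bounds
the divergence below by a squared Hellinger distance, and that by the squared difference. -/
theorem sq_sub_le_sqrt {x y : ℝ} (hx : x ∈ Set.Icc (0 : ℝ) 1) (hy : y ∈ Set.Icc (0 : ℝ) 1) :
    (x - y) ^ 2 / 4 ≤ x + y - 2 * (√x * √y) := by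
  have h1 := Real.mul_self_sqrt hx.1
  have h2 := Real.mul_self_sqrt hy.1
  have h3 : √x ≤ 1 := Real.sqrt_le_one.2 hx.2
  have h4 : √y ≤ 1 := Real.sqrt_le_one.2 hy.2
  have h5 := Real.sqrt_nonneg x
  have h6 := Real.sqrt_nonneg y
  have h7 : (x - y) ^ 2 = (√x - √y) ^ 2 * (√x + √y) ^ 2 := by
    rw [← mul_pow, ← h1, ← h2]
    simp only [Real.sqrt_mul_self h5, Real.sqrt_mul_self h6]
    ring
  have h8 : (√x + √y) ^ 2 ≤ 4 := by nlinarith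
  have h9 : x + y - 2 * (√x * √y) = (√x - √y) ^ 2 := by
    nlinarith
  rw [h7, h9]
  nlinarith [mul_le_mul_of_nonneg_left h8 (sq_nonneg (√x - √y))]

theorem sq_sub_le_realKL {x y : ℝ} (hx : x ∈ Set.Icc (0 : ℝ) 1) (hy : y ∈ Set.Ioo (0 : ℝ) 1) :
    (x - y) ^ 2 / 2 ≤ realKL x y := by
  have hx' : 1 - x ∈ Set.Icc (0 : ℝ) 1 := ⟨by linarith [hx.2], by linarith [hx.1]⟩
  have hy' : 1 - y ∈ Set.Icc (0 : ℝ) 1 := ⟨by linarith [hy.2], by linarith [hy.1]⟩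
  have h1 := mul_log_div_ge hx.1 hy.1
  have h2 := mul_log_div_ge hx'.1 (sub_pos.2 hy.2)
  have h3 := sq_sub_le_sqrt hx ⟨hy.1.le, hy.2.le⟩
  have h4 := sq_sub_le_sqrt hx' hy'
  unfold realKL
  nlinarith

theorem realKL_nonneg {x y : ℝ} (hx : x ∈ Set.Icc (0 : ℝ) 1) (hy : y ∈ Set.Ioo (0 : ℝ) 1) :
    0 ≤ realKL x y :=
  (by positivity : (0 : ℝ) ≤ (x - y) ^ 2 / 2).trans (sq_sub_le_realKL hx hy)

/-- A weak form of Pinsker's inequality. -/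
theorem sq_sub_le_bernoulliKL {x y : ℝ} (hx : x ∈ Set.Icc (0 : ℝ) 1)
    (hy : y ∈ Set.Icc (0 : ℝ) 1) :
    ENNReal.ofReal ((x - y) ^ 2 / 2) ≤ bernoulliKL x y := by
  rcases eq_or_ne x y with rfl | hxy
  · simp
  rcases hy.1.eq_or_lt with rfl | h0
  · rw [bernoulliKL_zero_right hxy]; exact le_top
  rcases hy.2.eq_or_lt with rfl | h1
  · rw [bernoulliKL_one_right hxy]; exact le_top
  rw [bernoulliKL_of_mem_Ioo ⟨h0, h1⟩]
  exact ENNReal.ofReal_le_ofReal (sq_sub_le_realKL hx ⟨h0, h1⟩)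

/-- The excess of the right side is `(z - x) * (log (y / z) + log ((1 - z) / (1 - y)))`, a product
of nonnegative factors. -/
theorem realKL_add_le {x z y : ℝ} (hx : 0 ≤ x) (hxz : x ≤ z) (hzy : z ≤ y) (hz : 0 < z)
    (hy : y < 1) : realKL x z + realKL z y ≤ realKL x y := by
  have hy0 : 0 < y := hz.trans_le hzy
  have hz1 : z < 1 := hzy.trans_lt hy
  have key : realKL x y - realKL x z - realKL z y =
      (z - x) * (Real.log (y / z) + Real.log ((1 - z) / (1 - y))) := by
    have e1 : x * Real.log (x / y) = x * Real.log (x / z) + x * Real.log (z / y) := by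
      rcases hx.eq_or_lt with rfl | hx
      · simp
      rw [Real.log_div hx.ne' hy0.ne', Real.log_div hx.ne' hz.ne', Real.log_div hz.ne' hy0.ne']
      ring
    have e2 : (1 - x) * Real.log ((1 - x) / (1 - y)) =
        (1 - x) * Real.log ((1 - x) / (1 - z)) + (1 - x) * Real.log ((1 - z) / (1 - y)) := by
      have a : (1 - x) ≠ 0 := by linarith
      have b : (1 - y) ≠ 0 := by linarith
      have c : (1 - z) ≠ 0 := by linarith
      rw [Real.log_div a b, Real.log_div a c, Real.log_div c b]
      ring
    have e3 : Real.log (y / z) = - Real.log (z / y) := by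
      rw [← Real.log_inv, inv_div]
    unfold realKL
    rw [e1, e2, e3]
    ring
  have h1 : 0 ≤ Real.log (y / z) := Real.log_nonneg ((one_le_div hz).2 hzy)
  have h2 : 0 ≤ Real.log ((1 - z) / (1 - y)) :=
    Real.log_nonneg ((one_le_div (by linarith)).2 (by linarith))
  nlinarith [mul_nonneg (sub_nonneg.2 hxz) (add_nonneg h1 h2)]

/-- The divergence is superadditive along monotone chains of Bernoulli laws. -/
theorem bernoulliKL_add_le {x z y : ℝ} (hx : 0 ≤ x) (hxz : x ≤ z) (hzy : z ≤ y) (hy : y ≤ 1) :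
    bernoulliKL x z + bernoulliKL z y ≤ bernoulliKL x y := by
  rcases eq_or_ne x z with rfl | h
  · simp [bernoulliKL_self]
  have hz : 0 < z := hx.trans_lt (lt_of_le_of_ne hxz h)
  rcases hy.eq_or_lt with rfl | hy
  · rw [bernoulliKL_one_right (x := x) (by have := lt_of_le_of_ne hxz h; linarith)]
    exact le_top
  have hz1 : z < 1 := hzy.trans_lt hy
  have hzI : z ∈ Set.Ioo (0 : ℝ) 1 := ⟨hz, hz1⟩
  have hyI : y ∈ Set.Ioo (0 : ℝ) 1 := ⟨hz.trans_le hzy, hy⟩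
  rw [bernoulliKL_of_mem_Ioo hzI, bernoulliKL_of_mem_Ioo hyI, bernoulliKL_of_mem_Ioo hyI,
    ← ENNReal.ofReal_add (realKL_nonneg ⟨hx, by linarith⟩ hzI)
      (realKL_nonneg ⟨hz.le, hz1.le⟩ hyI)]
  exact ENNReal.ofReal_le_ofReal (realKL_add_le hx hxz hzy hz hy)

theorem bernoulliKL_mono_right {x z y : ℝ} (hx : 0 ≤ x) (hxz : x ≤ z) (hzy : z ≤ y)
    (hy : y ≤ 1) : bernoulliKL x z ≤ bernoulliKL x y :=
  le_self_add.trans (bernoulliKL_add_le hx hxz hzy hy)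

theorem bernoulliKL_anti_left {x z y : ℝ} (hx : 0 ≤ x) (hxz : x ≤ z) (hzy : z ≤ y)
    (hy : y ≤ 1) : bernoulliKL z y ≤ bernoulliKL x y :=
  le_add_self.trans (bernoulliKL_add_le hx hxz hzy hy)

/-- The entropy of `x` is at most `log 2`, and the term `-x log y` is nonnegative. This quantifies
the blow-up of the divergence as `y` tends to 1. -/
theorem realKL_ge_log {x y : ℝ} (hx : x ∈ Set.Icc (0 : ℝ) 1) (hy : y ∈ Set.Ioo (0 : ℝ) 1) :
    (1 - x) * -Real.log (1 - y) - Real.log 2 ≤ realKL x y := by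
  have h := Real.binEntropy_le_log_two (p := x)
  rw [Real.binEntropy_eq_negMulLog_add_negMulLog_one_sub] at h
  unfold Real.negMulLog at h
  have hlog : Real.log y ≤ 0 := Real.log_nonpos hy.1.le hy.2.le
  have hy1 : 0 < 1 - y := by linarith [hy.2]
  have e1 : x * Real.log (x / y) = x * Real.log x - x * Real.log y := by
    rcases hx.1.eq_or_lt with rfl | hx
    · simp
    rw [Real.log_div hx.ne' hy.1.ne']; ring
  have e2 : (1 - x) * Real.log ((1 - x) / (1 - y)) =
      (1 - x) * Real.log (1 - x) - (1 - x) * Real.log (1 - y) := by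
    rcases hx.2.eq_or_lt with rfl | hx
    · simp
    rw [Real.log_div (by linarith) hy1.ne']; ring
  unfold realKL
  rw [e1, e2]
  nlinarith [mul_nonneg hx.1 (neg_nonneg.2 hlog)]

theorem continuousAt_realKL_shift {x y : ℝ} (hy : y ∈ Set.Ioo (0 : ℝ) 1) :
    ContinuousAt (fun d : ℝ => realKL (x + d) (y - d)) 0 := by
  -- With the quotients inside the logarithms split, the first argument enters through `s log s`,
  -- which is continuous also at `s = 0`; so `x = 0` needs no separate treatment.
  have hform : (fun d : ℝ => (x + d) * Real.log (x + d) - (x + d) * Real.log (y - d) +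
      ((1 - (x + d)) * Real.log (1 - (x + d)) - (1 - (x + d)) * Real.log (1 - (y - d))))
      =ᶠ[nhds 0] fun d : ℝ => realKL (x + d) (y - d) := by
    have h0 : ∀ᶠ d : ℝ in nhds 0, 0 < y - d := by
      have : ContinuousAt (fun d : ℝ => y - d) 0 := by fun_prop
      exact this.eventually_const_lt (by simpa using hy.1)
    have h1 : ∀ᶠ d : ℝ in nhds 0, 0 < 1 - (y - d) := by
      have : ContinuousAt (fun d : ℝ => 1 - (y - d)) 0 := by fun_prop
      exact this.eventually_const_lt (by simpa using hy.2)
    filter_upwards [h0, h1] with d h0 h1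
    have aux : ∀ a b : ℝ, 0 < b → a * Real.log (a / b) = a * Real.log a - a * Real.log b := by
      intro a b hb
      rcases eq_or_ne a 0 with rfl | ha
      · simp
      rw [Real.log_div ha hb.ne']; ring
    unfold realKL
    rw [aux _ _ h0, aux _ _ h1]
  refine ContinuousAt.congr ?_ hform
  have hm := Real.continuous_mul_log
  have c1 : Continuous fun d : ℝ => (x + d) * Real.log (x + d) :=
    hm.comp (continuous_const.add continuous_id)
  have c2 : Continuous fun d : ℝ => (1 - (x + d)) * Real.log (1 - (x + d)) :=
    hm.comp (continuous_const.sub (continuous_const.add continuous_id))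
  have l1 : ContinuousAt (fun d : ℝ => Real.log (y - d)) 0 :=
    ContinuousAt.log (by fun_prop) (by simpa using hy.1.ne')
  have l2 : ContinuousAt (fun d : ℝ => Real.log (1 - (y - d))) 0 :=
    ContinuousAt.log (by fun_prop) (by simpa [sub_eq_zero] using hy.2.ne')
  refine (c1.continuousAt.sub (ContinuousAt.mul (by fun_prop) l1)).add
    (c2.continuousAt.sub (ContinuousAt.mul (by fun_prop) l2))

/-- The divergence hardly drops if its arguments move towards each other. -/
theorem exists_realKL_le_mul_shift {x y η : ℝ} (hx : 0 ≤ x) (hxy : x < y) (hy : y < 1)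
    (hη : 0 < η) : ∃ d > 0, x + d < y - d ∧ 0 < realKL (x + d) (y - d) ∧
      realKL x y ≤ (1 + η) * realKL (x + d) (y - d) := by
  have hyI : y ∈ Set.Ioo (0 : ℝ) 1 := ⟨hx.trans_lt hxy, hy⟩
  have hpos : 0 < realKL x y :=
    (by have := sub_pos.2 hxy; have : x - y ≠ 0 := by linarith
        positivity : (0 : ℝ) < (x - y) ^ 2 / 2).trans_le
      (sq_sub_le_realKL ⟨hx, by linarith⟩ hyI)
  have hlt : realKL x y / (1 + η) < realKL (x + 0) (y - 0) := by
    rw [add_zero, sub_zero, div_lt_iff₀ (by linarith)]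
    nlinarith
  have h1 := (continuousAt_realKL_shift (x := x) hyI).eventually_const_lt hlt
  have h2 : ∀ᶠ d : ℝ in nhds 0, d < (y - x) / 2 := eventually_lt_nhds (by linarith)
  have h3 : ∀ᶠ d : ℝ in nhdsWithin 0 (Set.Ioi 0), 0 < d := eventually_mem_nhdsWithin
  obtain ⟨d, ⟨hd1, hd2⟩, hd3⟩ := (((h1.and h2).filter_mono nhdsWithin_le_nhds).and h3).exists
  refine ⟨d, hd3, by linarith, (div_pos hpos (by linarith)).trans hd1, ?_⟩
  rw [div_lt_iff₀ (by linarith)] at hd1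
  linarith

/-! ### Counting plays, leads and successes along a path -/

section Counting

variable {K : ℕ} (a : ℕ → Fin K) (k : Fin K)

theorem pulls_eq_count (t : ℕ) : pulls a k t = Nat.count (fun n => a n = k) t :=
  (Nat.count_eq_card_filter_range _ _).symm

theorem pulls_zero : pulls a k 0 = 0 := by simp [pulls]

theorem pulls_succ (t : ℕ) : pulls a k (t + 1) = pulls a k t + if a t = k then 1 else 0 := by
  simp only [pulls_eq_count, Nat.count_succ]

theorem pulls_mono : Monotone (pulls a k) := by
  intro s t h
  simp only [pulls_eq_count]
  exact Nat.count_monotone _ h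

theorem pulls_le (t : ℕ) : pulls a k t ≤ t := by
  rw [pulls_eq_count]
  exact Nat.count_le _

variable {a k}

/-- The rounds that play a given arm are numbered by its earlier plays; the counting arguments below
rest on this injection. -/
theorem pulls_injective {s t : ℕ} (hs : a s = k) (ht : a t = k)
    (h : pulls a k s = pulls a k t) : s = t := by
  simp only [pulls_eq_count] at h
  exact Nat.count_injective (p := fun n => a n = k) hs ht h

theorem exists_pulls_eq {l t : ℕ} (h : l < pulls a k t) :
    ∃ s < t, a s = k ∧ pulls a k s = l := by
  induction t with
  | zero => simp [pulls_zero] at h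
  | succ t ih =>
    rw [pulls_succ] at h
    by_cases hl : l < pulls a k t
    · obtain ⟨s, hs, h'⟩ := ih hl
      exact ⟨s, hs.trans (Nat.lt_succ_self t), h'⟩
    · split_ifs at h with hk
      · exact ⟨t, Nat.lt_succ_self t, hk, by omega⟩
      · omega

/-- Since `leadCount` includes the current round, `leadCount lead t - 1` is the number of earlier
leads, and the selection rule depends on that number modulo 3. -/
theorem leadCount_eq (lead : ℕ → Fin K) (t : ℕ) :
    leadCount lead t = pulls lead (lead t) t + 1 := by
  have : leadCount lead t = pulls lead (lead t) (t + 1) := rfl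
  rw [this, pulls_succ, if_pos rfl]

theorem sum_pulls (a : ℕ → Fin K) (t : ℕ) : ∑ k, pulls a k t = t := by
  induction t with
  | zero => simp [pulls_zero]
  | succ t ih => simp [pulls_succ, Finset.sum_add_distrib, ih]

/-- The number of successes of arm `k` in the first `t` rounds. -/
def successes (x : ℕ → Fin K → Bool) (arm : ℕ → Fin K) (k : Fin K) (t : ℕ) : ℕ :=
  ((Finset.range t).filter fun n => arm n = k ∧ x n k = true).card

variable {x : ℕ → Fin K → Bool} {arm lead : ℕ → Fin K}

theorem successes_succ (t : ℕ) : successes x arm k (t + 1) =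
    successes x arm k t + if arm t = k ∧ x t k = true then 1 else 0 := by
  unfold successes
  rw [Finset.range_add_one, Finset.filter_insert]
  split_ifs with h
  · rw [Finset.card_insert_of_notMem (by simp)]
  · rfl

theorem successes_le_pulls (t : ℕ) : successes x arm k t ≤ pulls arm k t :=
  Finset.card_le_card fun n hn => by
    simp only [Finset.mem_filter] at hn ⊢
    exact ⟨hn.1, hn.2.1⟩

theorem empMean_eq (p : Fin K → ℝ) (t : ℕ) :
    empMean p x arm k t = p k * ((successes x arm k t : ℝ) / (pulls arm k t : ℝ)) := by
  unfold empMean successes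
  split_ifs with h
  · simp [h]
  · rw [← Finset.sum_filter, Finset.sum_const, nsmul_eq_mul]
    ring

theorem successes_div_mem (t : ℕ) :
    (successes x arm k t : ℝ) / (pulls arm k t : ℝ) ∈ Set.Icc (0 : ℝ) 1 :=
  ⟨by positivity, div_le_one_of_le₀ (by exact_mod_cast successes_le_pulls t) (by positivity)⟩

theorem empMean_div {p : Fin K → ℝ} (hp : 0 < p k) (t : ℕ) :
    empMean p x arm k t / p k = (successes x arm k t : ℝ) / (pulls arm k t : ℝ) := by
  rw [empMean_eq, mul_div_cancel_left₀ _ hp.ne']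

theorem empMean_div_mem {p : Fin K → ℝ} (hp : 0 < p k) (t : ℕ) :
    empMean p x arm k t / p k ∈ Set.Icc (0 : ℝ) 1 := by
  rw [empMean_div hp]
  exact successes_div_mem t

theorem empMean_mem {p : Fin K → ℝ} (hp : 0 < p k) (t : ℕ) :
    empMean p x arm k t ∈ Set.Icc (0 : ℝ) (p k) := by
  have h := empMean_div_mem (x := x) (arm := arm) hp t
  exact ⟨by have := mul_nonneg h.1 hp.le; rwa [div_mul_cancel₀ _ hp.ne'] at this,
    (div_le_one hp).1 h.2⟩

theorem FollowsUBA.pulls_le_three_mul {p : Fin K → ℝ} {c : ℝ} {A : Fin K → Finset (Fin K)}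
    (h : FollowsUBA p c A x lead arm) (k : Fin K) (t : ℕ) :
    pulls lead k t ≤ 3 * pulls arm k t := by
  -- The invariant with the quotient rounded up survives induction: it grows exactly when the number
  -- of earlier leads is a multiple of 3, and then the leader is played.
  suffices (pulls lead k t + 2) / 3 ≤ pulls arm k t by omega
  induction t with
  | zero => simp [pulls_zero]
  | succ t ih =>
    simp only [pulls_succ]
    by_cases hk : lead t = k
    · by_cases h3 : 3 ∣ pulls lead k t
      · have := h.play_leader t (by rw [leadCount_eq, hk, Nat.add_sub_cancel]; exact h3)
        rw [if_pos hk, if_pos (this.trans hk)]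
        omega
      · rw [if_pos hk]
        omega
    · rw [if_neg hk]
      omega

end Counting

/-! ### The exploration rate -/

section Exploration

theorem one_le_log_of_three_le {l : ℕ} (hl : 3 ≤ l) : 1 ≤ Real.log l := by
  rw [Real.le_log_iff_exp_le (by positivity)]
  have : (3 : ℝ) ≤ l := by exact_mod_cast hl
  linarith [Real.exp_one_lt_d9]

theorem log_le_explorationRate {c : ℝ} (hc : 0 < c) {l : ℕ} (hl : 3 ≤ l) :
    Real.log l ≤ explorationRate c l := by
  unfold explorationRate
  have := mul_nonneg hc.le (Real.log_nonneg (one_le_log_of_three_le hl))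
  linarith

theorem explorationRate_nonneg {c : ℝ} (hc : 0 < c) {l : ℕ} (hl : 3 ≤ l) :
    0 ≤ explorationRate c l :=
  (zero_le_one.trans (one_le_log_of_three_le hl)).trans (log_le_explorationRate hc hl)

/-- The double logarithm costs an arbitrarily small multiple of the logarithm. -/
theorem explorationRate_le {c η : ℝ} (hc : 0 < c) (hη : 0 < η) {l : ℕ} (hl : 3 ≤ l) :
    explorationRate c l ≤ (1 + η) * Real.log l + c * (Real.log (c / η)) := by
  unfold explorationRate
  have h1 := one_le_log_of_three_le hl
  -- The inequality `log w ≤ w - 1` at `w = (η / c) log l`, scaled so that multiplication by `c`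
  -- yields `η log l`.
  have h2 : Real.log (η / c * Real.log l) ≤ η / c * Real.log l - 1 :=
    Real.log_le_sub_one_of_pos (by positivity)
  rw [Real.log_mul (by positivity) (by positivity)] at h2
  have h3 : Real.log (η / c) = - Real.log (c / η) := by rw [← Real.log_inv, inv_div]
  have h4 := mul_le_mul_of_nonneg_left h2 hc.le
  have h5 : c * (η / c * Real.log l - 1) = η * Real.log l - c := by field_simp
  rw [h5, h3] at h4
  linarith

theorem explorationRate_le_mul_log {c : ℝ} (hc : 0 < c) {l : ℕ} (hl : 3 ≤ l) :
    explorationRate c l ≤ (1 + c) * Real.log l := by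
  simpa [div_self hc.ne'] using explorationRate_le hc hc hl

end Exploration

/-! ### The KL-UCB index -/

section Index

variable {K : ℕ} {p : Fin K → ℝ} {c : ℝ} {x : ℕ → Fin K → Bool} {lead arm : ℕ → Fin K}
  {k : Fin K} {t : ℕ}

theorem coe_ennreal_le_coe_iff {u : ℝ≥0∞} {v : ℝ} (hv : 0 ≤ v) :
    (u : EReal) ≤ (v : EReal) ↔ u ≤ ENNReal.ofReal v := by
  rw [← EReal.coe_ennreal_le_coe_ennreal_iff, EReal.coe_ennreal_ofReal, max_eq_left hv]

/-- The set whose supremum is the index of arm `k`. -/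
def indexSet (p : Fin K → ℝ) (c : ℝ) (x : ℕ → Fin K → Bool) (lead arm : ℕ → Fin K) (k : Fin K)
    (t : ℕ) : Set ℝ :=
  {q | q ∈ Set.Icc 0 (p k) ∧ bernoulliKL (empMean p x arm k t / p k) (q / p k) ≤
    ENNReal.ofReal (explorationRate c (leadCount lead t) / (pulls arm k t : ℝ))}

theorem index_eq (hf : 0 ≤ explorationRate c (leadCount lead t)) (hn : pulls arm k t ≠ 0) :
    index p c x lead arm k t = sSup (indexSet p c x lead arm k t) := by
  unfold index indexSet
  rw [if_neg hn]
  simp only [coe_ennreal_le_coe_iff (div_nonneg hf (Nat.cast_nonneg (pulls arm k t)))]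

theorem bddAbove_indexSet : BddAbove (indexSet p c x lead arm k t) :=
  ⟨p k, fun _ hq => hq.1.2⟩

theorem empMean_mem_indexSet (hp : 0 < p k) :
    empMean p x arm k t ∈ indexSet p c x lead arm k t :=
  ⟨empMean_mem hp t, by rw [bernoulliKL_self]; exact zero_le⟩

theorem empMean_le_index (hp : 0 < p k) (hf : 0 ≤ explorationRate c (leadCount lead t)) :
    empMean p x arm k t ≤ index p c x lead arm k t := by
  by_cases hn : pulls arm k t = 0
  · rw [index, if_pos hn]
    exact (empMean_mem hp t).2
  · rw [index_eq hf hn]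
    exact le_csSup bddAbove_indexSet (empMean_mem_indexSet hp)

theorem index_le (hp : 0 < p k) : index p c x lead arm k t ≤ p k := by
  unfold index
  split_ifs
  · exact le_rfl
  · exact Real.sSup_le (fun q hq => hq.1.2) hp.le

theorem exists_of_lt_index {v : ℝ} (hp : 0 < p k)
    (hf : 0 ≤ explorationRate c (leadCount lead t)) (hn : pulls arm k t ≠ 0)
    (hv : v < index p c x lead arm k t) : ∃ q, v < q ∧ q ≤ p k ∧
      bernoulliKL (empMean p x arm k t / p k) (q / p k) ≤
        ENNReal.ofReal (explorationRate c (leadCount lead t) / (pulls arm k t : ℝ)) := by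
  rw [index_eq hf hn] at hv
  obtain ⟨q, hq, hvq⟩ := exists_lt_of_lt_csSup ⟨_, empMean_mem_indexSet hp⟩ hv
  exact ⟨q, hvq, hq.1.2, hq.2⟩

theorem lt_bernoulliKL_of_index_lt {v : ℝ} (hv : v ∈ Set.Icc 0 (p k))
    (hf : 0 ≤ explorationRate c (leadCount lead t)) (hn : pulls arm k t ≠ 0)
    (h : index p c x lead arm k t < v) :
    ENNReal.ofReal (explorationRate c (leadCount lead t) / (pulls arm k t : ℝ)) <
      bernoulliKL (empMean p x arm k t / p k) (v / p k) := by
  rw [index_eq hf hn] at h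
  by_contra! hle
  exact h.not_ge (le_csSup bddAbove_indexSet ⟨hv, hle⟩)

/-- By the weak Pinsker inequality, a candidate value exceeding the empirical mean by more than `δ`
would have divergence at least `(δ / p k) ^ 2 / 2`, too large for the exploration bound. -/
theorem index_le_empMean_add {δ : ℝ} (hp : 0 < p k) (hδ : 0 < δ)
    (hf : 0 ≤ explorationRate c (leadCount lead t)) (hn : pulls arm k t ≠ 0)
    (hlt : explorationRate c (leadCount lead t) / (pulls arm k t : ℝ) < (δ / p k) ^ 2 / 2) :
    index p c x lead arm k t ≤ empMean p x arm k t + δ := by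
  by_contra! h
  obtain ⟨q, hq, hqp, hle⟩ := exists_of_lt_index hp hf hn h
  have hm := empMean_mem (x := x) (arm := arm) hp t
  have hq' : q / p k ∈ Set.Icc (0 : ℝ) 1 :=
    ⟨div_nonneg (by linarith [hm.1]) hp.le, (div_le_one hp).2 hqp⟩
  have h1 := (sq_sub_le_bernoulliKL (empMean_div_mem hp t) hq').trans hle
  rw [ENNReal.ofReal_le_ofReal_iff (div_nonneg hf (Nat.cast_nonneg _))] at h1
  have h2 : δ / p k ≤ q / p k - empMean p x arm k t / p k := by
    rw [← sub_div]
    exact div_le_div_of_nonneg_right (by linarith) hp.le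
  have h3 : (δ / p k) ^ 2 ≤ (q / p k - empMean p x arm k t / p k) ^ 2 :=
    pow_le_pow_left₀ (by positivity) h2 2
  nlinarith

end Index

/-! ### Long leads of a suboptimal arm, path by path -/

section Paths

variable {K : ℕ}

/-- At some time with `n` plays of arm `j`, its empirical mean is off by at least `r n`. -/
def Deviates (p θ : Fin K → ℝ) (x : ℕ → Fin K → Bool) (arm : ℕ → Fin K) (j : Fin K) (r : ℕ → ℝ)
    (n : ℕ) : Prop :=
  ∃ t, pulls arm j t = n ∧ r n ≤ |empMean p x arm j t - p j * θ j|

/-- At some time the empirical success rate of arm `j` is below `q` and refutes `q` at level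
`a`. -/
def Undershoots (x : ℕ → Fin K → Bool) (arm : ℕ → Fin K) (j : Fin K) (q a : ℝ) : Prop :=
  ∃ t, 0 < pulls arm j t ∧ (successes x arm j t : ℝ) / pulls arm j t < q ∧
    ENNReal.ofReal (a / pulls arm j t) <
      bernoulliKL ((successes x arm j t : ℝ) / pulls arm j t) q

variable {p θ : Fin K → ℝ} {c : ℝ} {A : Fin K → Finset (Fin K)} {x : ℕ → Fin K → Bool}
  {lead arm : ℕ → Fin K}

/-- An arm with a better neighbour does not lead long, unless some empirical mean is off or the
neighbour is underrated. -/
theorem FollowsUBA.deviates_of_lt_pulls_lead (h : FollowsUBA p c A x lead arm)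
    (hp : ∀ k, 0 < p k) (hθ : ∀ k, θ k ∈ Set.Icc (0 : ℝ) 1) (hc : 0 < c) {k j : Fin K}
    (hj : j ∈ A k) {δ : ℝ} (hδ : 0 < δ) (hgap : p k * θ k + 4 * δ = p j * θ j) {L T : ℕ}
    (hL : 1 ≤ L / (6 * (K + 1)))
    (hf : ∀ i, (1 + c) * Real.log L / (L / (6 * (K + 1)) : ℕ) < (δ / p i) ^ 2 / 2)
    (hT : L < pulls lead k T) :
    (∃ n, L / (6 * (K + 1)) ≤ n ∧ Deviates p θ x arm k (fun _ => δ) n) ∨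
    (∃ n, L / (6 * (K + 1)) ≤ n ∧ Deviates p θ x arm j (fun _ => δ) n) ∨
    Undershoots x arm j ((p j * θ j - δ) / p j) (Real.log (L / 4)) := by
  obtain ⟨t₀, -, hlead₀, hcount₀⟩ := exists_pulls_eq hT
  by_contra! hcon
  obtain ⟨hk, hj', hund⟩ := hcon
  set M := L / (6 * (K + 1)) with hM
  set N := L / 6 with hN
  have hMN : M = N / (K + 1) := by rw [hM, hN, Nat.div_div_eq_div_mul]
  have hMN' : M * (K + 1) ≤ N := by rw [hMN]; exact Nat.div_mul_le_self _ _
  have hMN2 : M ≤ N := le_trans (Nat.le_mul_of_pos_right _ (Nat.succ_pos K)) hMN'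
  have hM3 : 3 * N ≤ L := by omega
  -- the neighbour has not been played often
  have hjt₀ : pulls arm j t₀ < M := by
    by_contra! hge
    have hkt₀ : M ≤ pulls arm k t₀ := by
      have := h.pulls_le_three_mul k t₀
      omega
    have h1 : |empMean p x arm k t₀ - p k * θ k| < δ := by
      by_contra! hd
      exact hk _ hkt₀ ⟨t₀, rfl, hd⟩
    have h2 : |empMean p x arm j t₀ - p j * θ j| < δ := by
      by_contra! hd
      exact hj' _ hge ⟨t₀, rfl, hd⟩
    have h3 := h.leader_max t₀ j
    rw [hlead₀] at h3
    rw [abs_lt] at h1 h2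
    linarith
  -- Round `τ i` has `3 * (N + i) + 1` earlier leads of `k`, which is not a multiple of 3, so an arm
  -- of largest index is played there. Starting at `3 * N` leads guarantees `k` at least `M` plays
  -- and keeps `log (leadCount)` above `log (L / 4)`.
  have hex : ∀ i : ℕ, ∃ t, i < N → t < t₀ ∧ lead t = k ∧ pulls lead k t = 3 * (N + i) + 1 := by
    intro i
    by_cases hi : i < N
    · obtain ⟨t, ht⟩ := exists_pulls_eq (a := lead) (k := k) (l := 3 * (N + i) + 1) (t := t₀)
        (by omega)
      exact ⟨t, fun _ => ht⟩
    · exact ⟨0, fun h => absurd h hi⟩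
  choose τ hτ using hex
  have hfew : ∀ i < N, pulls arm (arm (τ i)) (τ i) < M := by
    intro i hi
    obtain ⟨hlt, hlead, hcount⟩ := hτ i hi
    by_contra! hge
    have hlc : leadCount lead (τ i) = 3 * (N + i) + 2 := by rw [leadCount_eq, hlead, hcount]
    have hl3 : 3 ≤ leadCount lead (τ i) := by omega
    have hlL : leadCount lead (τ i) ≤ L := by omega
    obtain ⟨-, hmax⟩ := h.play_index (τ i) (by rw [hlc]; omega)
    rw [hlead] at hmax
    have hrate := explorationRate_nonneg hc hl3
    have hpos : 0 < pulls arm (arm (τ i)) (τ i) := by omega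
    have hidx : index p c x lead arm (arm (τ i)) (τ i) ≤
        empMean p x arm (arm (τ i)) (τ i) + δ := by
      refine index_le_empMean_add (hp _) hδ hrate hpos.ne' ((hf (arm (τ i))).trans_le' ?_)
      have hMpos : (0 : ℝ) < M := by exact_mod_cast hL
      have hlog : Real.log (leadCount lead (τ i)) ≤ Real.log L :=
        Real.log_le_log (by positivity) (by exact_mod_cast hlL)
      have h1 := one_le_log_of_three_le hl3
      refine div_le_div₀ (by nlinarith) ?_ hMpos (by exact_mod_cast hge)
      exact (explorationRate_le_mul_log hc hl3).trans
        (mul_le_mul_of_nonneg_left hlog (by linarith))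
    have hkt : M ≤ pulls arm k (τ i) := by
      have := h.pulls_le_three_mul k (τ i)
      omega
    have h1 : |empMean p x arm k (τ i) - p k * θ k| < δ := by
      by_contra! hd
      exact hk _ hkt ⟨τ i, rfl, hd⟩
    rw [abs_lt] at h1
    have h2 := h.leader_max (τ i) (arm (τ i))
    rw [hlead] at h2
    -- The played arm has index at most its mean plus `δ`, its mean is at most that of the leader
    -- `k`, and the latter is below `p k * θ k + δ`. The index of `j` is thus below `p k * θ k + 2 *
    -- δ = p j * θ j - 2 * δ`.
    have hjlt : index p c x lead arm j (τ i) < p j * θ j - δ :=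
      (hmax j hj).trans_lt (by linarith)
    have hθj := hθ j
    have hμj : p j * θ j ≤ p j := mul_le_of_le_one_right (hp j).le hθj.2
    have hμk : 0 ≤ p k * θ k := mul_nonneg (hp k).le (hθ k).1
    have hjpos : pulls arm j (τ i) ≠ 0 := by
      intro h0
      rw [index, if_pos h0] at hjlt
      linarith
    have hkl := lt_bernoulliKL_of_index_lt ⟨by linarith, by linarith⟩ hrate hjpos hjlt
    rw [empMean_div (hp j)] at hkl
    refine hund ⟨τ i, Nat.pos_of_ne_zero hjpos, ?_, hkl.trans_le' ?_⟩
    · rw [← empMean_div (hp j)]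
      exact div_lt_div_of_pos_right ((empMean_le_index (hp j) hrate).trans_lt hjlt) (hp j)
    · refine ENNReal.ofReal_le_ofReal (div_le_div_of_nonneg_right ?_ (Nat.cast_nonneg _))
      refine le_trans ?_ (log_le_explorationRate hc hl3)
      have hL' : (0 : ℝ) < L := by
        have : 0 < L := by omega
        exact_mod_cast this
      refine Real.log_le_log (by linarith) ?_
      rw [div_le_iff₀ (by norm_num)]
      have : L ≤ leadCount lead (τ i) * 4 := by omega
      exact_mod_cast this
  -- A round is determined by the arm played and the earlier plays of that arm, so there are at most
  -- `K * M` rounds `τ i`. This contradicts `(K + 1) * M ≤ N`.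
  have hcard := Finset.card_le_card_of_injOn (s := Finset.range N)
    (t := (Finset.univ : Finset (Fin K)) ×ˢ Finset.range M)
    (fun i => (arm (τ i), pulls arm (arm (τ i)) (τ i)))
    (fun i hi => by
      simpa using hfew i (by simpa using hi))
    (fun i hi i' hi' hii => by
      simp only [Finset.coe_range, Set.mem_Iio] at hi hi'
      simp only [Prod.mk.injEq] at hii
      have e : τ i = τ i' := pulls_injective rfl hii.1.symm (by rw [hii.2, hii.1])
      have h1 := (hτ i hi).2.2
      have h2 := (hτ i' hi').2.2
      rw [e] at h1
      omega)
  simp only [Finset.card_range, Finset.card_product, Finset.card_univ, Fintype.card_fin] at hcard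
  nlinarith

end Paths

/-! ### Measurability of the path statistics -/

section Measurability

variable {Ω : Type*} {K : ℕ} {k : Fin K}

theorem measurable_pulls {_ : MeasurableSpace Ω} {a : ℕ → Ω → Fin K} {t : ℕ}
    (h : ∀ n < t, Measurable (a n)) : Measurable fun ω => pulls (fun n => a n ω) k t := by
  induction t with
  | zero => simp [pulls_zero]
  | succ t ih =>
    simp only [pulls_succ]
    refine (ih fun n hn => h n (by omega)).add (Measurable.ite ?_ measurable_const measurable_const)
    exact h t (by omega) (measurableSet_singleton k)

theorem measurable_successes {_ : MeasurableSpace Ω} {arm : ℕ → Ω → Fin K}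
    {X : ℕ → Ω → Fin K → Bool} {t : ℕ} (h : ∀ n < t, Measurable (arm n))
    (hX : ∀ n < t, Measurable (X n)) :
    Measurable fun ω => successes (fun n => X n ω) (fun n => arm n ω) k t := by
  induction t with
  | zero => simp [successes]
  | succ t ih =>
    simp only [successes_succ]
    refine (ih (fun n hn => h n (by omega)) fun n hn => hX n (by omega)).add
      (Measurable.ite ?_ measurable_const measurable_const)
    exact MeasurableSet.inter (h t (by omega) (measurableSet_singleton k))
      (((measurable_pi_apply k).comp (hX t (by omega))) (measurableSet_singleton true))

theorem IsBernoulliBandit.measurable {m : MeasurableSpace Ω} {P : Measure Ω}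
    {ℱ : Filtration ℕ m} {θ : Fin K → ℝ} {X : ℕ → Ω → Fin K → Bool}
    (hX : IsBernoulliBandit P ℱ θ X) (t : ℕ) : Measurable (X t) :=
  (hX.adapted t).mono (ℱ.le _) le_rfl

end Measurability

/-! ### Binomial probabilities and the divergence -/

section Binomial

theorem successes_eq_of_pulls_eq {K : ℕ} {x : ℕ → Fin K → Bool} {arm : ℕ → Fin K} {j : Fin K}
    {s t : ℕ} (hst : s ≤ t) (h : pulls arm j s = pulls arm j t) :
    successes x arm j s = successes x arm j t := by
  induction t, hst using Nat.le_induction with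
  | base => rfl
  | succ t hst ih =>
    have h1 := pulls_mono arm j hst
    rw [pulls_succ] at h
    have hne : arm t ≠ j := by
      intro he
      rw [if_pos he] at h
      omega
    rw [if_neg hne] at h
    rw [ih h, successes_succ, if_neg (fun h => hne h.1), Nat.add_zero]

/-- The binomial probabilities decay at the rate given by the divergence. -/
theorem choose_mul_le_exp {n s : ℕ} (hn : 0 < n) (hs : s ≤ n) {θ b : ℝ}
    (hθ : θ ∈ Set.Icc (0 : ℝ) 1)
    (hb : ENNReal.ofReal b ≤ n * bernoulliKL ((s : ℝ) / n) θ) :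
    (n.choose s : ℝ) * θ ^ s * (1 - θ) ^ (n - s) ≤ Real.exp (-b) := by
  have hn' : (0 : ℝ) < n := by exact_mod_cast hn
  have hself : ∀ {x : ℝ}, (s : ℝ) / n = x → θ = x →
      (n.choose s : ℝ) * θ ^ s * (1 - θ) ^ (n - s) ≤ 1 →
      (n.choose s : ℝ) * θ ^ s * (1 - θ) ^ (n - s) ≤ Real.exp (-b) := by
    intro x h1 h2 h3
    rw [h1, h2, bernoulliKL_self, mul_zero, nonpos_iff_eq_zero, ENNReal.ofReal_eq_zero] at hb
    exact h3.trans (Real.one_le_exp (by linarith))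
  rcases hθ.1.eq_or_lt with h0 | h0
  · rcases Nat.eq_zero_or_pos s with rfl | hs0
    · exact hself (by simp) h0.symm (by simp [← h0])
    · rw [← h0, zero_pow hs0.ne', mul_zero, zero_mul]
      exact (Real.exp_pos _).le
  rcases hθ.2.eq_or_lt with h1 | h1
  · rcases hs.eq_or_lt with rfl | hsn
    · exact hself (div_self hn'.ne') h1 (by simp [h1])
    · rw [h1, sub_self, zero_pow (by omega), mul_zero]
      exact (Real.exp_pos _).le
  set x : ℝ := (s : ℝ) / n with hx
  have hx0 : 0 ≤ x := by positivity
  have hx1 : x ≤ 1 := div_le_one_of_le₀ (by exact_mod_cast hs) hn'.le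
  have hnx : (n : ℝ) * x = s := by rw [hx]; field_simp
  have hns : ((n - s : ℕ) : ℝ) = n * (1 - x) := by
    rw [Nat.cast_sub hs, mul_sub, mul_one, hnx]
  have hI : θ ∈ Set.Ioo (0 : ℝ) 1 := ⟨h0, h1⟩
  have hkl := realKL_nonneg ⟨hx0, hx1⟩ hI
  rw [bernoulliKL_of_mem_Ioo hI, ← ENNReal.ofReal_natCast, ← ENNReal.ofReal_mul hn'.le,
    ENNReal.ofReal_le_ofReal_iff (by positivity)] at hb
  -- Change of measure from parameter `θ` to the empirical frequency `x = s / n`, one factor at a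
  -- time; the implication covers `u = 0`, where both sides are 1.
  have factor : ∀ (u v : ℝ) (i : ℕ), 0 ≤ u → 0 < v → (u = 0 → i = 0) →
      v ^ i = u ^ i * Real.exp (-(i * Real.log (u / v))) := by
    intro u v i hu hv hi
    rcases hu.eq_or_lt with hu0 | hu
    · simp [hi hu0.symm]
    · rw [Real.exp_neg, Real.exp_nat_mul, Real.exp_log (by positivity), ← inv_pow, inv_div,
        ← mul_pow, mul_div_cancel₀ _ hu.ne']
  have e1 := factor x θ s hx0 h0 (fun h => by
    rw [h, mul_zero] at hnx
    exact_mod_cast hnx.symm)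
  have e2 := factor (1 - x) (1 - θ) (n - s) (by linarith) (by linarith) (fun h => by
    rw [h, mul_zero] at hns
    exact_mod_cast hns)
  -- Under parameter `x` this is the probability of one value of a binomial variable.
  have hbin : (n.choose s : ℝ) * x ^ s * (1 - x) ^ (n - s) ≤ 1 := by
    have h := add_pow x (1 - x) n
    rw [add_sub_cancel, one_pow] at h
    have := Finset.single_le_sum (f := fun i => x ^ i * (1 - x) ^ (n - i) * (n.choose i : ℝ))
      (fun i _ => mul_nonneg (mul_nonneg (pow_nonneg hx0 _) (pow_nonneg (by linarith) _))
        (Nat.cast_nonneg _)) (Finset.mem_range.2 (Nat.lt_succ_of_le hs))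
    calc _ = x ^ s * (1 - x) ^ (n - s) * (n.choose s : ℝ) := by ring
      _ ≤ _ := this
      _ = 1 := h.symm
  calc (n.choose s : ℝ) * θ ^ s * (1 - θ) ^ (n - s)
      = ((n.choose s : ℝ) * x ^ s * (1 - x) ^ (n - s)) * Real.exp (-(n * realKL x θ)) := by
        rw [e1, e2, hns, ← hnx]
        have : Real.exp (-(n * realKL x θ)) = Real.exp (-(n * x * Real.log (x / θ))) *
            Real.exp (-(n * (1 - x) * Real.log ((1 - x) / (1 - θ)))) := by
          rw [← Real.exp_add]
          unfold realKL
          ring_nf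
        rw [this]
        ring
    _ ≤ 1 * Real.exp (-b) := by
        refine mul_le_mul hbin (Real.exp_le_exp.2 (by linarith)) (Real.exp_pos _).le zero_le_one
    _ = _ := one_mul _

end Binomial

/-! ### Concentration for adaptively sampled arms -/

section Concentration

variable {Ω : Type*} {m : MeasurableSpace Ω} {K : ℕ} {P : Measure Ω} [IsProbabilityMeasure P]
  {ℱ : Filtration ℕ m} {θ : Fin K → ℝ} {X : ℕ → Ω → Fin K → Bool} {arm : ℕ → Ω → Fin K}

theorem IsBernoulliBandit.measure_inter (hX : IsBernoulliBandit P ℱ θ X) {t : ℕ} {E : Set Ω}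
    (hE : MeasurableSet[ℱ t] E) (j : Fin K) (b : Bool) :
    P (E ∩ {ω | X t ω j = b}) = ENNReal.ofReal (if b = true then θ j else 1 - θ j) * P E := by
  have hmeas : ∀ b : Bool, MeasurableSet[MeasurableSpace.comap (X t) inferInstance]
      {ω | X t ω j = b} := fun b =>
    ⟨(fun y : Fin K → Bool => y j) ⁻¹' {b}, measurable_pi_apply j (measurableSet_singleton b), rfl⟩
  have hm : ∀ b : Bool, MeasurableSet {ω | X t ω j = b} := fun b =>
    ((measurable_pi_apply j).comp (hX.measurable t)) (measurableSet_singleton b)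
  have h := (Indep_iff _ _ P).1 (hX.indep t) _ _ (hmeas b) hE
  rw [Set.inter_comm, h]
  congr 1
  cases b
  · have hc : {ω | X t ω j = false} = {ω | X t ω j = true}ᶜ := by
      ext ω; simp
    rw [if_neg (by simp), ← hX.prob t j, hc, ← probReal_compl_eq_one_sub (hm true),
      ofReal_measureReal]
  · rw [if_pos rfl, ← hX.prob t j, ofReal_measureReal]

/-- The first `n` plays of an arm are dominated by independent Bernoulli trials. -/
theorem IsBernoulliBandit.measure_pulls_successes_le (hX : IsBernoulliBandit P ℱ θ X)
    (hθ : ∀ k, θ k ∈ Set.Icc (0 : ℝ) 1) (harm : ∀ t, Measurable[ℱ t] (arm t)) (j : Fin K)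
    (n s : ℕ) :
    P {ω | ∃ t, pulls (fun i => arm i ω) j t = n ∧
        successes (fun i => X i ω) (fun i => arm i ω) j t = s} ≤
      ENNReal.ofReal ((n.choose s : ℝ) * θ j ^ s * (1 - θ j) ^ (n - s)) := by
  have hθ0 := (hθ j).1
  have hθ1 : 0 ≤ 1 - θ j := sub_nonneg.2 (hθ j).2
  induction n generalizing s with
  | zero =>
    rcases Nat.eq_zero_or_pos s with rfl | hs
    · simpa using prob_le_one
    · have : {ω | ∃ t, pulls (fun i => arm i ω) j t = 0 ∧
          successes (fun i => X i ω) (fun i => arm i ω) j t = s} = ∅ := by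
        rw [Set.eq_empty_iff_forall_notMem]
        rintro ω ⟨t, h1, h2⟩
        have := successes_le_pulls (x := fun i => X i ω) (arm := fun i => arm i ω) (k := j) t
        omega
      rw [this, measure_empty]
      exact zero_le
  | succ n ih =>
    -- `E s t` says that round `t` is the play number `n + 1` of arm `j` and `s` successes precede
    -- it. It is known before round `t`, hence independent of the outcome in round `t`. The events
    -- are disjoint in `t`, and conditioning on that outcome turns the induction step into Pascal's
    -- rule. There is only an inequality because the arm may never be played `n + 1` times.
    set E : ℕ → ℕ → Set Ω := fun s t => {ω | arm t ω = j ∧ pulls (fun i => arm i ω) j t = n ∧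
      successes (fun i => X i ω) (fun i => arm i ω) j t = s} with hEdef
    have hE : ∀ s t, MeasurableSet[ℱ t] (E s t) := fun s t => by
      have h1 : Measurable[ℱ t] fun ω => pulls (fun i => arm i ω) j t :=
        measurable_pulls fun i hi => (harm i).mono (ℱ.mono hi.le) le_rfl
      have h2 : Measurable[ℱ t] fun ω =>
          successes (fun i => X i ω) (fun i => arm i ω) j t :=
        measurable_successes (fun i hi => (harm i).mono (ℱ.mono hi.le) le_rfl)
          (fun i hi => (hX.adapted i).mono (ℱ.mono hi) le_rfl)
      exact @MeasurableSet.inter _ (ℱ t) _ _ (harm t (measurableSet_singleton j))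
        (@MeasurableSet.inter _ (ℱ t) _ _ (h1 (measurableSet_singleton n))
          (h2 (measurableSet_singleton s)))
    have hdisj : ∀ s, Pairwise (Function.onFun Disjoint (E s)) := by
      intro s t t' htt'
      rw [Function.onFun, Set.disjoint_left]
      rintro ω ⟨h1, h2, -⟩ ⟨h1', h2', -⟩
      exact htt' (pulls_injective h1 h1' (h2.trans h2'.symm))
    have hstep : ∀ s b, P (⋃ t, E s t ∩ {ω | X t ω j = b}) ≤
        ENNReal.ofReal (if b = true then θ j else 1 - θ j) *
          ENNReal.ofReal ((n.choose s : ℝ) * θ j ^ s * (1 - θ j) ^ (n - s)) := by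
      intro s b
      calc P (⋃ t, E s t ∩ {ω | X t ω j = b})
          ≤ ∑' t, P (E s t ∩ {ω | X t ω j = b}) := measure_iUnion_le _
        _ = ENNReal.ofReal (if b = true then θ j else 1 - θ j) * P (⋃ t, E s t) := by
          rw [measure_iUnion (hdisj s) fun t => ℱ.le t _ (hE s t), ← ENNReal.tsum_mul_left]
          exact tsum_congr fun t => hX.measure_inter (hE s t) j b
        _ ≤ _ := by
          gcongr
          refine (measure_mono ?_).trans (ih s)
          rintro ω hω
          obtain ⟨t, -, h⟩ := Set.mem_iUnion.1 hω
          exact ⟨t, h⟩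
    have hlast : ∀ ω, ∀ t, pulls (fun i => arm i ω) j t = n + 1 → ∃ u, arm u ω = j ∧
        pulls (fun i => arm i ω) j u = n ∧
        successes (fun i => X i ω) (fun i => arm i ω) j t =
          successes (fun i => X i ω) (fun i => arm i ω) j u +
            if X u ω j = true then 1 else 0 := by
      intro ω t h1
      obtain ⟨u, hut, hu, hn⟩ := exists_pulls_eq
        (show n < pulls (fun i => arm i ω) j t by omega)
      refine ⟨u, hu, hn, ?_⟩
      have h2 : pulls (fun i => arm i ω) j (u + 1) = pulls (fun i => arm i ω) j t := by
        rw [pulls_succ, if_pos hu, hn, h1]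
      rw [← successes_eq_of_pulls_eq hut h2, successes_succ]
      simp [hu]
    rcases s with _ | s
    · refine (measure_mono (t := ⋃ t, E 0 t ∩ {ω | X t ω j = false}) ?_).trans
        ((hstep 0 false).trans ?_)
      · rintro ω ⟨t, h1, h2⟩
        obtain ⟨u, hu1, hu2, hu3⟩ := hlast ω t h1
        rw [h2] at hu3
        refine Set.mem_iUnion.2 ⟨u, ⟨hu1, hu2, by omega⟩, ?_⟩
        by_contra hb
        rw [Set.mem_ofPred_eq, Bool.not_eq_false] at hb
        rw [if_pos hb] at hu3
        omega
      · rw [if_neg (by simp), ← ENNReal.ofReal_mul hθ1]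
        refine ENNReal.ofReal_le_ofReal (le_of_eq ?_)
        simp only [Nat.choose_zero_right, Nat.cast_one, pow_zero, Nat.sub_zero, pow_succ]
        ring
    · refine (measure_mono (t := (⋃ t, E s t ∩ {ω | X t ω j = true}) ∪
        ⋃ t, E (s + 1) t ∩ {ω | X t ω j = false}) ?_).trans ((measure_union_le _ _).trans
        ((add_le_add (hstep s true) (hstep (s + 1) false)).trans ?_))
      · rintro ω ⟨t, h1, h2⟩
        obtain ⟨u, hu1, hu2, hu3⟩ := hlast ω t h1
        rw [h2] at hu3
        by_cases hb : X u ω j = true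
        · rw [if_pos hb] at hu3
          exact Or.inl (Set.mem_iUnion.2 ⟨u, ⟨hu1, hu2, by omega⟩, hb⟩)
        · rw [if_neg hb] at hu3
          exact Or.inr (Set.mem_iUnion.2 ⟨u, ⟨hu1, hu2, by omega⟩, by simpa using hb⟩)
      · rw [if_pos rfl, if_neg (by simp), ← ENNReal.ofReal_mul hθ0, ← ENNReal.ofReal_mul hθ1,
          ← ENNReal.ofReal_add (by positivity) (by positivity)]
        refine ENNReal.ofReal_le_ofReal (le_of_eq ?_)
        rw [Nat.choose_succ_succ, Nat.succ_sub_succ, Nat.cast_add]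
        by_cases hsn : s + 1 ≤ n
        · obtain ⟨d, rfl⟩ := Nat.exists_eq_add_of_le hsn
          have e1 : s + 1 + d - s = d + 1 := by omega
          have e2 : s + 1 + d - (s + 1) = d := by omega
          rw [e1, e2]
          ring
        · rw [Nat.choose_eq_zero_of_lt (show n < s + 1 by omega)]
          simp only [Nat.cast_zero, zero_mul, mul_zero, add_zero]
          ring

/-- A bound of Sanov type for the first `n` plays of an arm. -/
theorem IsBernoulliBandit.measure_successes_mem_le (hX : IsBernoulliBandit P ℱ θ X)
    (hθ : ∀ k, θ k ∈ Set.Icc (0 : ℝ) 1) (harm : ∀ t, Measurable[ℱ t] (arm t)) (j : Fin K)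
    {n : ℕ} (hn : 0 < n) (S : Set ℕ) {b : ℝ}
    (hb : ∀ s ∈ S, s ≤ n → ENNReal.ofReal b ≤ n * bernoulliKL ((s : ℝ) / n) (θ j)) :
    P {ω | ∃ t, pulls (fun i => arm i ω) j t = n ∧
        successes (fun i => X i ω) (fun i => arm i ω) j t ∈ S} ≤
      ENNReal.ofReal ((n + 1) * Real.exp (-b)) := by
  classical
  have hsub : {ω | ∃ t, pulls (fun i => arm i ω) j t = n ∧
        successes (fun i => X i ω) (fun i => arm i ω) j t ∈ S} ⊆
      ⋃ s ∈ (Finset.range (n + 1)).filter (· ∈ S), {ω | ∃ t, pulls (fun i => arm i ω) j t = n ∧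
        successes (fun i => X i ω) (fun i => arm i ω) j t = s} := by
    rintro ω ⟨t, h1, h2⟩
    refine Set.mem_iUnion₂.2 ⟨_, ?_, t, h1, rfl⟩
    have := successes_le_pulls (x := fun i => X i ω) (arm := fun i => arm i ω) (k := j) t
    simp only [Finset.mem_filter, Finset.mem_range]
    exact ⟨by omega, h2⟩
  refine (measure_mono hsub).trans ((measure_biUnion_finset_le _ _).trans ?_)
  refine (Finset.sum_le_card_nsmul _ _ (ENNReal.ofReal (Real.exp (-b))) ?_).trans ?_
  · intro s hs
    simp only [Finset.mem_filter, Finset.mem_range] at hs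
    refine (hX.measure_pulls_successes_le hθ harm j n s).trans (ENNReal.ofReal_le_ofReal ?_)
    exact choose_mul_le_exp hn (by omega) (hθ j) (hb s hs.2 (by omega))
  · have hcard : ((Finset.range (n + 1)).filter (· ∈ S)).card ≤ n + 1 :=
      (Finset.card_filter_le _ _).trans (by simp)
    rw [ENNReal.ofReal_mul (by positivity), nsmul_eq_mul]
    gcongr
    rw [← ENNReal.ofReal_natCast]
    exact ENNReal.ofReal_le_ofReal (by exact_mod_cast hcard)

theorem measurableSet_deviates (p : Fin K → ℝ) (hX : ∀ t, Measurable (X t))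
    (harm : ∀ t, Measurable (arm t)) (j : Fin K) (r : ℕ → ℝ) (n : ℕ) :
    MeasurableSet {ω | Deviates p θ (fun i => X i ω) (fun i => arm i ω) j r n} := by
  unfold Deviates
  rw [Set.ofPred_exists]
  refine MeasurableSet.iUnion fun t => ?_
  have h := (measurable_pulls (k := j) (t := t) fun n _ => harm n).prodMk
    (measurable_successes (k := j) (t := t) (fun n _ => harm n) fun n _ => hX n)
  simp only [empMean_eq]
  exact h (MeasurableSet.of_discrete (s := {y : ℕ × ℕ | y.1 = n ∧
    r n ≤ |p j * ((y.2 : ℝ) / (y.1 : ℝ)) - p j * θ j|}))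

/-- With `u = √(n + 1)` the exponent is at most `κ - κ * u`. The term of order 8 of the exponential
series, `8! = 40320`, turns the factor `u ^ 4` into `u ^ (-4)`. -/
theorem exp_neg_sqrt_le {κ : ℝ} (hκ : 0 < κ) (n : ℕ) :
    ((n : ℝ) + 1) ^ 2 * Real.exp (-(n * (κ / √((n : ℝ) + 1)))) ≤
      (Real.exp κ * 40320 / κ ^ 8) * (1 / ((n : ℝ) + 1) ^ 2) := by
  set u : ℝ := √((n : ℝ) + 1) with hu
  have hu0 : 0 < u := Real.sqrt_pos.2 (by positivity)
  have hu1 : 1 ≤ u := by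
    rw [hu, Real.one_le_sqrt]
    linarith [(Nat.cast_nonneg n : (0 : ℝ) ≤ n)]
  have husq : u ^ 2 = n + 1 := Real.sq_sqrt (by positivity)
  have hn : (n : ℝ) = u ^ 2 - 1 := by linarith
  have h1 : κ * u - κ ≤ n * (κ / u) := by
    have : κ / u ≤ κ := div_le_self hκ.le hu1
    have : n * (κ / u) = κ * u - κ / u := by rw [hn]; field_simp
    linarith
  have h2 := Real.pow_div_factorial_le_exp (κ * u) (by positivity) 8
  have h3 : (Nat.factorial 8 : ℝ) = 40320 := by norm_num [Nat.factorial]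
  rw [h3, div_le_iff₀ (by norm_num)] at h2
  have h4 : Real.exp (-(n * (κ / u))) ≤ Real.exp κ * (Real.exp (κ * u))⁻¹ := by
    rw [← Real.exp_neg, ← Real.exp_add]
    exact Real.exp_le_exp.2 (by linarith)
  have h5 : (Real.exp (κ * u))⁻¹ ≤ 40320 / (κ * u) ^ 8 := by
    rw [inv_le_comm₀ (Real.exp_pos _) (by positivity), inv_div, div_le_iff₀ (by norm_num)]
    exact h2
  rw [← husq]
  calc (u ^ 2) ^ 2 * Real.exp (-(n * (κ / u)))
      ≤ (u ^ 2) ^ 2 * (Real.exp κ * (40320 / (κ * u) ^ 8)) := by gcongr; exact h4.trans (by gcongr)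
    _ = _ := by field_simp

/-- Deviations of the empirical mean of an arm by more than the order `n ^ (-1 / 4)` have summable
probabilities, even with the weights `n + 1`. -/
theorem IsBernoulliBandit.tsum_deviates_ne_top (hX : IsBernoulliBandit P ℱ θ X)
    (hθ : ∀ k, θ k ∈ Set.Icc (0 : ℝ) 1) (harm : ∀ t, Measurable[ℱ t] (arm t))
    {p : Fin K → ℝ} {j : Fin K} (hp : 0 < p j) {d : ℝ} (hd : 0 < d) {r : ℕ → ℝ}
    (hr : ∀ n : ℕ, d / √(√((n : ℝ) + 1)) ≤ r n) :
    ∑' n : ℕ, ((n : ℝ≥0∞) + 1) *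
      P {ω | Deviates p θ (fun i => X i ω) (fun i => arm i ω) j r n} ≠ ⊤ := by
  set κ : ℝ := (d / p j) ^ 2 / 2 with hκ
  have hκ0 : 0 < κ := by positivity
  have hbound : ∀ n : ℕ, P {ω | Deviates p θ (fun i => X i ω) (fun i => arm i ω) j r n} ≤
      ENNReal.ofReal (((n : ℝ) + 1) * Real.exp (-(n * (κ / √((n : ℝ) + 1))))) := by
    intro n
    rcases Nat.eq_zero_or_pos n with rfl | hn
    · simpa using prob_le_one
    have hset : {ω | Deviates p θ (fun i => X i ω) (fun i => arm i ω) j r n} ⊆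
        {ω | ∃ t, pulls (fun i => arm i ω) j t = n ∧
          successes (fun i => X i ω) (fun i => arm i ω) j t ∈
            {s : ℕ | r n ≤ |p j * ((s : ℝ) / n) - p j * θ j|}} := by
      rintro ω ⟨t, h1, h2⟩
      refine ⟨t, h1, ?_⟩
      rwa [empMean_eq, h1] at h2
    refine (measure_mono hset).trans (hX.measure_successes_mem_le hθ harm j hn _ ?_)
    intro s hs hsn
    have hn' : (0 : ℝ) < n := by exact_mod_cast hn
    rw [ENNReal.ofReal_mul (Nat.cast_nonneg n), ENNReal.ofReal_natCast]
    gcongr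
    refine le_trans (ENNReal.ofReal_le_ofReal ?_) (sq_sub_le_bernoulliKL
      ⟨by positivity, div_le_one_of_le₀ (by exact_mod_cast hsn) hn'.le⟩ (hθ j))
    have h1 : d / √(√((n : ℝ) + 1)) / p j ≤ |(s : ℝ) / n - θ j| := by
      rw [div_le_iff₀ hp]
      refine (hr n).trans (le_trans hs (le_of_eq ?_))
      rw [← mul_sub, abs_mul, abs_of_pos hp, mul_comm]
    have h2 := pow_le_pow_left₀ (by positivity) h1 2
    rw [sq_abs, div_pow, div_pow, Real.sq_sqrt (Real.sqrt_nonneg _)] at h2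
    rw [hκ, div_pow]
    calc d ^ 2 / p j ^ 2 / 2 / √((n : ℝ) + 1) = d ^ 2 / √((n : ℝ) + 1) / p j ^ 2 / 2 := by
          field_simp
      _ ≤ _ := by gcongr
  have hsum : Summable fun n : ℕ =>
      (Real.exp κ * 40320 / κ ^ 8) * (1 / ((n : ℝ) + 1) ^ 2) := by
    refine Summable.mul_left _ ?_
    have := (summable_nat_add_iff 1).2 (Real.summable_one_div_nat_pow.2 (one_lt_two))
    simpa using this
  refine ne_top_of_le_ne_top hsum.tsum_ofReal_ne_top (ENNReal.tsum_le_tsum fun n => ?_)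
  have hcast : ((n : ℝ≥0∞) + 1) = ENNReal.ofReal ((n : ℝ) + 1) := by
    rw [ENNReal.ofReal_add (by positivity) zero_le_one]; simp
  refine (mul_le_mul_right (hbound n) _).trans ?_
  rw [hcast, ← ENNReal.ofReal_mul (by positivity)]
  refine ENNReal.ofReal_le_ofReal (le_trans (le_of_eq ?_) (exp_neg_sqrt_le hκ0 n))
  ring

/-- An arm of success probability above `q` hardly ever refutes `q`. -/
theorem IsBernoulliBandit.measure_undershoots_le (hX : IsBernoulliBandit P ℱ θ X)
    (hθ : ∀ k, θ k ∈ Set.Icc (0 : ℝ) 1) (harm : ∀ t, Measurable[ℱ t] (arm t)) {j : Fin K}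
    {q : ℝ} (hq : q < θ j) :
    ∃ C : ℝ≥0, ∃ η > (0 : ℝ), ∀ a : ℝ, 0 ≤ a →
      P {ω | Undershoots (fun i => X i ω) (fun i => arm i ω) j q a} ≤
        C * ENNReal.ofReal (Real.exp (-((1 + η) * a))) := by
  rcases le_or_gt q 0 with hq0 | hq0
  · refine ⟨0, 1, one_pos, fun a _ => ?_⟩
    have : {ω | Undershoots (fun i => X i ω) (fun i => arm i ω) j q a} = ∅ := by
      rw [Set.eq_empty_iff_forall_notMem]
      rintro ω ⟨t, -, h, -⟩
      exact absurd (h.trans_le hq0) (not_lt.2 (successes_div_mem t).1)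
    rw [this, measure_empty]
    exact zero_le
  have hq1 : q < 1 := hq.trans_le (hθ j).2
  have hqI : q ∈ Set.Ioo (0 : ℝ) 1 := ⟨hq0, hq1⟩
  set κ : ℝ := (q - θ j) ^ 2 / 2 with hκ
  have hκ0 : 0 < κ := by
    have : q - θ j ≠ 0 := by linarith
    positivity
  set I₀ : ℝ := realKL 0 q with hI₀
  have hI₀0 : 0 < I₀ := by
    have h := sq_sub_le_realKL ⟨le_rfl, zero_le_one⟩ hqI
    rw [zero_sub, neg_sq] at h
    exact lt_of_lt_of_le (by positivity) h
  have hsum : Summable fun n : ℕ => ((n : ℝ) + 1) * Real.exp (-(n * (κ / 2))) := by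
    have h1 : Real.exp (-(κ / 2)) < 1 := by
      rw [← Real.exp_zero]
      exact Real.exp_lt_exp.2 (by linarith)
    have h2 : ‖Real.exp (-(κ / 2))‖ < 1 := by rwa [Real.norm_of_nonneg (Real.exp_pos _).le]
    have h3 := (summable_pow_mul_geometric_of_norm_lt_one 1 h2).add
      (summable_geometric_of_norm_lt_one h2)
    refine h3.congr fun n => ?_
    rw [show -(n * (κ / 2)) = n * -(κ / 2) by ring, Real.exp_nat_mul]
    ring
  -- An undershoot with `n` plays has `a / n < I(s / n, q) ≤ I₀`, so `a < n * I₀`. By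
  -- superadditivity, `n * I(s / n, θ j)` is at least `a + n * κ`. Half of `n * κ` makes the sum
  -- over `n` converge; the other half is at least `κ / (2 * I₀) * a` and provides `η`.
  refine ⟨(∑' n : ℕ, ENNReal.ofReal (((n : ℝ) + 1) * Real.exp (-(n * (κ / 2))))).toNNReal,
    κ / (2 * I₀), by positivity, fun a ha => ?_⟩
  rw [ENNReal.coe_toNNReal hsum.tsum_ofReal_ne_top]
  have hset : {ω | Undershoots (fun i => X i ω) (fun i => arm i ω) j q a} ⊆
      ⋃ n : ℕ, {ω | ∃ t, pulls (fun i => arm i ω) j t = n ∧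
        successes (fun i => X i ω) (fun i => arm i ω) j t ∈
          {s : ℕ | 0 < n ∧ (s : ℝ) / n < q ∧
            ENNReal.ofReal (a / n) < bernoulliKL ((s : ℝ) / n) q}} := by
    rintro ω ⟨t, h⟩
    exact Set.mem_iUnion.2 ⟨_, t, rfl, h⟩
  refine (measure_mono hset).trans ((measure_iUnion_le _).trans ?_)
  rw [← ENNReal.tsum_mul_right]
  refine ENNReal.tsum_le_tsum fun n => ?_
  rcases Nat.eq_zero_or_pos n with rfl | hn
  · simp
  have hn' : (0 : ℝ) < n := by exact_mod_cast hn
  refine (hX.measure_successes_mem_le hθ harm j hn _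
    (b := n * (κ / 2) + (1 + κ / (2 * I₀)) * a) ?_).trans (le_of_eq ?_)
  · rintro s ⟨-, hs, hlt⟩ -
    have hs0 : (0 : ℝ) ≤ (s : ℝ) / n := by positivity
    have h1 : a < n * I₀ := by
      have := hlt.trans_le (bernoulliKL_anti_left le_rfl hs0 hs.le hq1.le)
      rw [bernoulliKL_of_mem_Ioo hqI, ENNReal.ofReal_lt_ofReal_iff hI₀0, div_lt_iff₀ hn'] at this
      linarith
    have h2 : κ / (2 * I₀) * a ≤ n * (κ / 2) := by
      have : κ / (2 * I₀) * a ≤ κ / (2 * I₀) * (n * I₀) := by gcongr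
      refine this.trans (le_of_eq ?_)
      field_simp
    calc ENNReal.ofReal (n * (κ / 2) + (1 + κ / (2 * I₀)) * a)
        ≤ ENNReal.ofReal (n * (a / n + κ)) := by
          refine ENNReal.ofReal_le_ofReal ?_
          rw [mul_add, mul_div_cancel₀ _ hn'.ne']
          linarith
      _ = n * (ENNReal.ofReal (a / n) + ENNReal.ofReal κ) := by
          rw [ENNReal.ofReal_mul hn'.le, ENNReal.ofReal_add (by positivity) hκ0.le,
            ENNReal.ofReal_natCast]
      _ ≤ n * (bernoulliKL ((s : ℝ) / n) q + bernoulliKL q (θ j)) := by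
          gcongr
          exact sq_sub_le_bernoulliKL ⟨hq0.le, hq1.le⟩ (hθ j)
      _ ≤ _ := by
          gcongr
          exact bernoulliKL_add_le hs0 hs.le hq.le (hθ j).2
  · rw [← ENNReal.ofReal_mul (by positivity), mul_assoc, ← Real.exp_add]
    congr 3
    ring_nf

end Concentration

/-! ### Suboptimal arms lead boundedly often -/

section Leaders

/-- After exchanging the sums, each `n` is counted for exactly `D * (n + 1)` values of `L`; hence
the weight `n + 1`. -/
theorem tsum_tsum_ite_div_le (D : ℕ) (hD : 0 < D) (f : ℕ → ℝ≥0∞)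
    (hf : ∑' n : ℕ, ((n : ℝ≥0∞) + 1) * f n ≠ ⊤) :
    ∑' L : ℕ, ∑' n : ℕ, (if L / D ≤ n then f n else 0) ≠ ⊤ := by
  rw [ENNReal.tsum_comm]
  have : ∀ n : ℕ, ∑' L : ℕ, (if L / D ≤ n then f n else 0) = D * (((n : ℝ≥0∞) + 1) * f n) := by
    intro n
    have hiff : ∀ L : ℕ, L / D ≤ n ↔ L ∈ Finset.range (D * (n + 1)) := fun L => by
      rw [Finset.mem_range, ← Nat.lt_succ_iff, Nat.div_lt_iff_lt_mul hD, mul_comm]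
    rw [tsum_eq_sum (s := Finset.range (D * (n + 1)))
      fun L hL => if_neg (fun h => hL ((hiff L).1 h)),
      Finset.sum_congr rfl fun L hL => if_pos ((hiff L).2 hL)]
    simp [mul_assoc]
  rw [tsum_congr this, ENNReal.tsum_mul_left]
  exact ENNReal.mul_ne_top (ENNReal.natCast_ne_top _) hf

theorem summable_exp_neg_mul_log {η : ℝ} (hη : 0 < η) :
    Summable fun L : ℕ => Real.exp (-((1 + η) * Real.log ((L : ℝ) / 4))) := by
  rw [← summable_nat_add_iff 1]
  have h := (summable_nat_add_iff 1).2
    (Real.summable_one_div_nat_rpow.2 (show (1 : ℝ) < 1 + η by linarith))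
  refine (h.mul_left ((4 : ℝ) ^ (1 + η))).congr fun n => ?_
  have hn : (0 : ℝ) < ((n + 1 : ℕ) : ℝ) := by positivity
  rw [mul_one_div, ← Real.div_rpow (by norm_num) hn.le, Real.rpow_def_of_pos (by positivity),
    ← inv_div, Real.log_inv]
  congr 1
  ring

theorem eventually_mul_log_div_lt {B b : ℝ} (hB : 0 ≤ B) (hb : 0 < b) {D : ℕ} (hD : 0 < D) :
    ∀ᶠ L : ℕ in Filter.atTop, 1 ≤ L / D ∧ B * Real.log L / (L / D : ℕ) < b := by
  have hlim : Filter.Tendsto (fun L : ℕ => B * (2 * D) * (Real.log L / L)) Filter.atTop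
      (nhds 0) := by
    have h := Real.isLittleO_log_id_atTop.tendsto_div_nhds_zero.comp
      (tendsto_natCast_atTop_atTop (R := ℝ))
    simpa using h.const_mul (B * (2 * D))
  filter_upwards [hlim.eventually_lt_const hb, Filter.eventually_ge_atTop (2 * D)] with L h1 h2
  have hLD : 1 ≤ L / D := (Nat.one_le_div_iff hD).2 (by omega)
  refine ⟨hLD, lt_of_le_of_lt ?_ h1⟩
  have hL : 0 < L := by omega
  have hL' : (0 : ℝ) < L := by exact_mod_cast hL
  have hD' : (0 : ℝ) < D := by exact_mod_cast hD
  have h3 : (L : ℝ) / (2 * D) ≤ (L / D : ℕ) := by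
    rw [div_le_iff₀ (by positivity)]
    have h4 := Nat.lt_mul_div_succ L hD
    have h5 : D ≤ D * (L / D) := Nat.le_mul_of_pos_right _ hLD
    have h6 : L ≤ L / D * (2 * D) := by nlinarith
    exact_mod_cast h6
  have hlog : 0 ≤ Real.log L := Real.log_natCast_nonneg L
  calc B * Real.log L / (L / D : ℕ) ≤ B * Real.log L / ((L : ℝ) / (2 * D)) := by gcongr
    _ = B * (2 * D) * (Real.log L / L) := by field_simp

variable {Ω : Type*} {m : MeasurableSpace Ω} {K : ℕ} {P : Measure Ω} [IsProbabilityMeasure P]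
  {ℱ : Filtration ℕ m} {p θ : Fin K → ℝ} {c : ℝ} {A : Fin K → Finset (Fin K)}
  {X : ℕ → Ω → Fin K → Bool} {lead arm : ℕ → Ω → Fin K}

/-- Lets `tsum_deviates_ne_top` serve for constant radii too. -/
theorem div_sqrt_sqrt_le {d : ℝ} (hd : 0 ≤ d) (n : ℕ) : d / √(√((n : ℝ) + 1)) ≤ d := by
  refine div_le_self hd ?_
  rw [Real.one_le_sqrt, Real.one_le_sqrt]
  linarith [(Nat.cast_nonneg n : (0 : ℝ) ≤ n)]

/-- An arm with a better neighbour leads a bounded number of times in expectation. -/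
theorem IsBernoulliBandit.exists_lintegral_pulls_lead_le (hX : IsBernoulliBandit P ℱ θ X)
    (hp : ∀ k, 0 < p k) (hθ : ∀ k, θ k ∈ Set.Icc (0 : ℝ) 1) (hc : 0 < c)
    (hlead : ∀ t, Measurable[ℱ t] (lead t)) (harm : ∀ t, Measurable[ℱ t] (arm t))
    (hUBA : ∀ᵐ ω ∂P, FollowsUBA p c A (fun n => X n ω) (fun n => lead n ω) (fun n => arm n ω))
    {k j : Fin K} (hj : j ∈ A k) (hlt : p k * θ k < p j * θ j) :
    ∃ C : ℝ≥0, ∀ T : ℕ, ∫⁻ ω, (pulls (fun n => lead n ω) k T : ℝ≥0∞) ∂P ≤ C := by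
  set δ : ℝ := (p j * θ j - p k * θ k) / 4 with hδ
  have hδ0 : 0 < δ := by rw [hδ]; linarith
  have hq : (p j * θ j - δ) / p j < θ j := by
    rw [div_lt_iff₀ (hp j)]
    linarith
  obtain ⟨C₀, η, hη, hund⟩ := hX.measure_undershoots_le hθ harm hq
  set D : ℕ := 6 * (K + 1) with hD
  have hDpos : 0 < D := by omega
  have hev : ∀ᶠ L : ℕ in Filter.atTop, ∀ i, 1 ≤ L / D ∧
      (1 + c) * Real.log L / (L / D : ℕ) < (δ / p i) ^ 2 / 2 :=
    Filter.eventually_all.2 fun i => eventually_mul_log_div_lt (by linarith)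
      (by have := hp i; positivity) hDpos
  obtain ⟨L₀, hL₀⟩ := Filter.eventually_atTop.1 hev
  set fk : ℕ → ℝ≥0∞ := fun n =>
    P {ω | Deviates p θ (fun i => X i ω) (fun i => arm i ω) k (fun _ => δ) n} with hfk
  set fj : ℕ → ℝ≥0∞ := fun n =>
    P {ω | Deviates p θ (fun i => X i ω) (fun i => arm i ω) j (fun _ => δ) n} with hfj
  have hSk := tsum_tsum_ite_div_le D hDpos fk
    (hX.tsum_deviates_ne_top hθ harm (hp k) hδ0 (div_sqrt_sqrt_le hδ0.le))
  have hSj := tsum_tsum_ite_div_le D hDpos fj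
    (hX.tsum_deviates_ne_top hθ harm (hp j) hδ0 (div_sqrt_sqrt_le hδ0.le))
  have hSu : ∑' L : ℕ, (C₀ : ℝ≥0∞) *
      ENNReal.ofReal (Real.exp (-((1 + η) * Real.log ((L : ℝ) / 4)))) ≠ ⊤ := by
    rw [ENNReal.tsum_mul_left]
    exact ENNReal.mul_ne_top ENNReal.coe_ne_top (summable_exp_neg_mul_log hη).tsum_ofReal_ne_top
  set g : ℕ → ℝ≥0∞ := fun L => (∑' n : ℕ, if L / D ≤ n then fk n else 0) +
    ((∑' n : ℕ, if L / D ≤ n then fj n else 0) +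
      C₀ * ENNReal.ofReal (Real.exp (-((1 + η) * Real.log ((L : ℝ) / 4))))) with hg
  have hgsum : ∑' L, g L ≠ ⊤ := by
    rw [hg, ENNReal.tsum_add, ENNReal.tsum_add]
    exact ENNReal.add_ne_top.2 ⟨hSk, ENNReal.add_ne_top.2 ⟨hSj, hSu⟩⟩
  have hbound : ∀ T L : ℕ, L₀ ≤ L → P {ω | L < pulls (fun n => lead n ω) k T} ≤ g L := by
    intro T L hL
    have hL1 := (hL₀ L hL k).1
    have hL6 : 6 ≤ L := by
      have h1 : D ≤ L := (Nat.one_le_div_iff hDpos).1 hL1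
      omega
    have hunion : ∀ i : Fin K, P {ω | ∃ n, L / D ≤ n ∧
        Deviates p θ (fun i => X i ω) (fun i => arm i ω) i (fun _ => δ) n} ≤
        ∑' n : ℕ, if L / D ≤ n then
          P {ω | Deviates p θ (fun i => X i ω) (fun i => arm i ω) i (fun _ => δ) n} else 0 := by
      intro i
      rw [Set.ofPred_exists]
      refine (measure_iUnion_le _).trans (ENNReal.tsum_le_tsum fun n => ?_)
      split_ifs with hn
      · exact measure_mono fun ω hω => hω.2
      · refine le_of_eq (measure_mono_null (t := ∅) (fun ω hω => hn hω.1) measure_empty)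
    calc P {ω | L < pulls (fun n => lead n ω) k T}
        ≤ P ({ω | ∃ n, L / D ≤ n ∧
            Deviates p θ (fun i => X i ω) (fun i => arm i ω) k (fun _ => δ) n} ∪
          ({ω | ∃ n, L / D ≤ n ∧
            Deviates p θ (fun i => X i ω) (fun i => arm i ω) j (fun _ => δ) n} ∪
          {ω | Undershoots (fun i => X i ω) (fun i => arm i ω) j ((p j * θ j - δ) / p j)
            (Real.log (L / 4))})) := by
          refine measure_mono_ae ?_
          filter_upwards [hUBA] with ω h hω
          exact h.deviates_of_lt_pulls_lead hp hθ hc hj hδ0 (by rw [hδ]; ring) hL1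
            (fun i => (hL₀ L hL i).2) hω
      _ ≤ g L := by
          refine (measure_union_le _ _).trans (add_le_add (hunion k)
            ((measure_union_le _ _).trans (add_le_add (hunion j) (hund _ ?_))))
          refine Real.log_nonneg ?_
          rw [le_div_iff₀ (by norm_num)]
          have : (6 : ℝ) ≤ L := by exact_mod_cast hL6
          linarith
  have hmeas : ∀ T : ℕ, Measurable fun ω => pulls (fun n => lead n ω) k T := fun T =>
    measurable_pulls fun n _ => (hlead n).mono (ℱ.le n) le_rfl
  refine ⟨L₀ + (∑' L, g L).toNNReal, fun T => ?_⟩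
  push_cast
  rw [ENNReal.coe_toNNReal hgsum]
  -- The expectation is the sum of the tail probabilities; those with `L < L₀` are bounded by 1, the
  -- others by the summable `g`.
  have hpoint : ∀ ω, (pulls (fun n => lead n ω) k T : ℝ≥0∞) = ∑ L ∈ Finset.range T,
      ({ω | L < pulls (fun n => lead n ω) k T} : Set Ω).indicator 1 ω := by
    intro ω
    have h1 : (Finset.range T).filter (fun L => L < pulls (fun n => lead n ω) k T) =
        Finset.range (pulls (fun n => lead n ω) k T) := by
      ext L
      have := pulls_le (fun n => lead n ω) k T
      simp only [Finset.mem_filter, Finset.mem_range]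
      omega
    simp only [Set.indicator_apply, Pi.one_apply, Set.mem_ofPred_eq]
    rw [Finset.sum_boole, h1, Finset.card_range]
  have hset : ∀ L : ℕ, MeasurableSet {ω | L < pulls (fun n => lead n ω) k T} := fun L =>
    hmeas T (MeasurableSet.of_discrete (s := {y : ℕ | L < y}))
  calc ∫⁻ ω, (pulls (fun n => lead n ω) k T : ℝ≥0∞) ∂P
      = ∑ L ∈ Finset.range T, P {ω | L < pulls (fun n => lead n ω) k T} := by
        simp_rw [hpoint]
        rw [lintegral_finsetSum _ fun L _ => measurable_one.indicator (hset L)]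
        exact Finset.sum_congr rfl fun L _ => lintegral_indicator_one (hset L)
    _ ≤ ∑ L ∈ Finset.range T, ((if L < L₀ then 1 else 0) + g L) := by
        refine Finset.sum_le_sum fun L _ => ?_
        split_ifs with h
        · exact prob_le_one.trans le_self_add
        · rw [zero_add]
          exact hbound T L (not_lt.1 h)
    _ ≤ L₀ + ∑' L, g L := by
        rw [Finset.sum_add_distrib]
        refine add_le_add ?_ (ENNReal.sum_le_tsum _)
        rw [Finset.sum_boole]
        refine Nat.cast_le.2 ?_
        calc _ ≤ (Finset.range L₀).card := Finset.card_le_card fun L hL => by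
              simp only [Finset.mem_filter, Finset.mem_range] at hL ⊢
              exact hL.2
          _ = L₀ := Finset.card_range _

end Leaders

/-! ### Plays of another arm while a fixed arm leads -/

section Plays

theorem card_le_card_of_pulls_mem {K : ℕ} {a : ℕ → Fin K} {k : Fin K} {S G : Finset ℕ}
    (h : ∀ t ∈ S, a t = k ∧ pulls a k t ∈ G) : S.card ≤ G.card :=
  Finset.card_le_card_of_injOn (pulls a k) (fun t ht => (h t ht).2)
    fun s hs t ht hst => pulls_injective (h s hs).1 (h t ht).1 hst

open Classical in
-- Rounds are charged to the clause that holds in them. Clauses on `j` are counted by plays of `j`,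
-- which number these rounds. A value `n` of `pulls arm k` may persist over many rounds, but those
-- in which `k` leads are numbered by `pulls lead k`, which is then at most `3 * n`; hence the
-- weight `3 * (n + 1)`.
theorem card_lead_arm_le {K : ℕ} {lead arm : ℕ → Fin K} {k j : Fin K} {T N L₀ : ℕ}
    {Q R : ℕ → Prop} (h3 : ∀ t, pulls lead k t ≤ 3 * pulls arm k t)
    (h : ∀ t < T, lead t = k → arm t = j →
      pulls lead k t < L₀ ∨ Q (pulls arm k t) ∨ R (pulls arm j t) ∨ pulls arm j t < N) :
    ((Finset.range T).filter fun t => lead t = k ∧ arm t = j).card ≤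
      L₀ + N + (∑ n ∈ (Finset.range T).filter Q, 3 * (n + 1)) +
        ((Finset.range T).filter R).card := by
  set S := (Finset.range T).filter fun t => lead t = k ∧ arm t = j with hS
  have hSmem : ∀ t ∈ S, t < T ∧ lead t = k ∧ arm t = j := fun t ht => by
    simpa [hS] using ht
  have hsub : S ⊆ (S.filter fun t => pulls lead k t < L₀) ∪ (S.filter fun t => pulls arm j t < N) ∪
      (S.filter fun t => Q (pulls arm k t)) ∪ (S.filter fun t => R (pulls arm j t)) := by
    intro t ht
    obtain ⟨h0, h1, h2⟩ := hSmem t ht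
    simp only [Finset.mem_union, Finset.mem_filter]
    have := h t h0 h1 h2
    tauto
  have c1 : (S.filter fun t => pulls lead k t < L₀).card ≤ L₀ := by
    refine (card_le_card_of_pulls_mem (a := lead) (k := k) (G := Finset.range L₀) ?_).trans
      (Finset.card_range _).le
    intro t ht
    rw [Finset.mem_filter] at ht
    exact ⟨(hSmem t ht.1).2.1, Finset.mem_range.2 ht.2⟩
  have c2 : (S.filter fun t => pulls arm j t < N).card ≤ N := by
    refine (card_le_card_of_pulls_mem (a := arm) (k := j) (G := Finset.range N) ?_).trans
      (Finset.card_range _).le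
    intro t ht
    rw [Finset.mem_filter] at ht
    exact ⟨(hSmem t ht.1).2.2, Finset.mem_range.2 ht.2⟩
  have c3 : (S.filter fun t => Q (pulls arm k t)).card ≤
      ∑ n ∈ (Finset.range T).filter Q, 3 * (n + 1) := by
    refine (card_le_card_of_pulls_mem (a := lead) (k := k)
      (G := ((Finset.range T).filter Q).biUnion fun n => Finset.range (3 * (n + 1))) ?_).trans
      (Finset.card_biUnion_le.trans (by simp))
    intro t ht
    rw [Finset.mem_filter] at ht
    obtain ⟨h0, h1, -⟩ := hSmem t ht.1
    refine ⟨h1, Finset.mem_biUnion.2 ⟨pulls arm k t, ?_, ?_⟩⟩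
    · rw [Finset.mem_filter, Finset.mem_range]
      exact ⟨(pulls_le arm k t).trans_lt h0, ht.2⟩
    · have := h3 t
      rw [Finset.mem_range]
      omega
  have c4 : (S.filter fun t => R (pulls arm j t)).card ≤ ((Finset.range T).filter R).card := by
    refine card_le_card_of_pulls_mem (a := arm) (k := j) fun t ht => ?_
    rw [Finset.mem_filter] at ht
    obtain ⟨h0, -, h1⟩ := hSmem t ht.1
    refine ⟨h1, ?_⟩
    rw [Finset.mem_filter, Finset.mem_range]
    exact ⟨(pulls_le arm j t).trans_lt h0, ht.2⟩
  have hu1 := Finset.card_le_card hsub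
  have hu2 := Finset.card_union_le ((S.filter fun t => pulls lead k t < L₀) ∪
    (S.filter fun t => pulls arm j t < N) ∪ (S.filter fun t => Q (pulls arm k t)))
    (S.filter fun t => R (pulls arm j t))
  have hu3 := Finset.card_union_le ((S.filter fun t => pulls lead k t < L₀) ∪
    (S.filter fun t => pulls arm j t < N)) (S.filter fun t => Q (pulls arm k t))
  have hu4 := Finset.card_union_le (S.filter fun t => pulls lead k t < L₀)
    (S.filter fun t => pulls arm j t < N)
  omega

/-- The number of rounds among the first `T` in which `k` leads and `j` is played. -/
def leadPulls {K : ℕ} (lead arm : ℕ → Fin K) (k j : Fin K) (T : ℕ) : ℕ :=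
  ((Finset.range T).filter fun t => lead t = k ∧ arm t = j).card

variable {Ω : Type*} {m : MeasurableSpace Ω} {K : ℕ} {P : Measure Ω} [IsProbabilityMeasure P]
  {ℱ : Filtration ℕ m} {p θ : Fin K → ℝ} {c : ℝ} {A : Fin K → Finset (Fin K)}
  {X : ℕ → Ω → Fin K → Bool} {lead arm : ℕ → Ω → Fin K}

/-- If arm `j` is played in the lead of `k` only when an empirical mean is off or `j` has had few
plays, then this happens few times in expectation. -/
theorem IsBernoulliBandit.exists_lintegral_leadPulls_le (hX : IsBernoulliBandit P ℱ θ X)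
    (hp : ∀ k, 0 < p k) (hθ : ∀ k, θ k ∈ Set.Icc (0 : ℝ) 1)
    (harm : ∀ t, Measurable[ℱ t] (arm t))
    (hUBA : ∀ᵐ ω ∂P, FollowsUBA p c A (fun n => X n ω) (fun n => lead n ω) (fun n => arm n ω))
    (k j : Fin K) (L₀ : ℕ) {d : ℝ} (hd : 0 < d) {r r' : ℕ → ℝ}
    (hr : ∀ n : ℕ, d / √(√((n : ℝ) + 1)) ≤ r n) (hr' : ∀ n : ℕ, d / √(√((n : ℝ) + 1)) ≤ r' n) :
    ∃ C : ℝ≥0, ∀ T N : ℕ,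
      (∀ᵐ ω ∂P, ∀ t < T, lead t ω = k → arm t ω = j →
        pulls (fun n => lead n ω) k t < L₀ ∨
        Deviates p θ (fun n => X n ω) (fun n => arm n ω) k r (pulls (fun n => arm n ω) k t) ∨
        Deviates p θ (fun n => X n ω) (fun n => arm n ω) j r' (pulls (fun n => arm n ω) j t) ∨
        pulls (fun n => arm n ω) j t < N) →
      ∫⁻ ω, (leadPulls (fun n => lead n ω) (fun n => arm n ω) k j T : ℝ≥0∞) ∂P ≤ N + C := by
  classical
  set E : ℕ → Set Ω := fun n =>
    {ω | Deviates p θ (fun n => X n ω) (fun n => arm n ω) k r n} with hE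
  set E' : ℕ → Set Ω := fun n =>
    {ω | Deviates p θ (fun n => X n ω) (fun n => arm n ω) j r' n} with hE'
  have hm : ∀ n, MeasurableSet (E n) := measurableSet_deviates p hX.measurable
    (fun t => (harm t).mono (ℱ.le t) le_rfl) k r
  have hm' : ∀ n, MeasurableSet (E' n) := measurableSet_deviates p hX.measurable
    (fun t => (harm t).mono (ℱ.le t) le_rfl) j r'
  have hs : ∑' n : ℕ, ((n : ℝ≥0∞) + 1) * P (E n) ≠ ⊤ :=
    hX.tsum_deviates_ne_top hθ harm (hp k) hd hr
  have hs' : ∑' n : ℕ, ((n : ℝ≥0∞) + 1) * P (E' n) ≠ ⊤ :=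
    hX.tsum_deviates_ne_top hθ harm (hp j) hd hr'
  refine ⟨L₀ + 3 * (∑' n : ℕ, ((n : ℝ≥0∞) + 1) * P (E n)).toNNReal +
    (∑' n : ℕ, ((n : ℝ≥0∞) + 1) * P (E' n)).toNNReal, fun T N hT => ?_⟩
  push_cast
  rw [ENNReal.coe_toNNReal hs, ENNReal.coe_toNNReal hs']
  have hpoint : ∀ᵐ ω ∂P,
      (leadPulls (fun n => lead n ω) (fun n => arm n ω) k j T : ℝ≥0∞) ≤ (L₀ + N : ℝ≥0∞) +
        (∑ n ∈ Finset.range T, 3 * ((n : ℝ≥0∞) + 1) * (E n).indicator 1 ω +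
          ∑ n ∈ Finset.range T, ((n : ℝ≥0∞) + 1) * (E' n).indicator 1 ω) := by
    filter_upwards [hUBA, hT] with ω h hω
    have hcard := card_lead_arm_le (T := T) (N := N) (L₀ := L₀) (h.pulls_le_three_mul k) hω
    refine (Nat.cast_le.2 hcard).trans ?_
    push_cast
    rw [add_assoc]
    refine add_le_add le_rfl (add_le_add ?_ ?_)
    · rw [Finset.sum_filter]
      refine Finset.sum_le_sum fun n _ => ?_
      simp only [Set.indicator_apply, hE, Set.mem_ofPred_eq, Pi.one_apply]
      split_ifs <;> simp
    · rw [← Finset.sum_boole]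
      refine Finset.sum_le_sum fun n _ => ?_
      simp only [Set.indicator_apply, hE', Set.mem_ofPred_eq, Pi.one_apply]
      split_ifs <;> simp
  have hi : ∀ n, Measurable ((E n).indicator (1 : Ω → ℝ≥0∞)) := fun n =>
    measurable_one.indicator (hm n)
  have hi' : ∀ n, Measurable ((E' n).indicator (1 : Ω → ℝ≥0∞)) := fun n =>
    measurable_one.indicator (hm' n)
  refine (lintegral_mono_ae hpoint).trans ?_
  rw [lintegral_add_left measurable_const, lintegral_add_left
    (Finset.measurable_sum _ fun n _ => (hi n).const_mul _),
    lintegral_finsetSum _ fun n _ => (hi n).const_mul _,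
    lintegral_finsetSum _ fun n _ => (hi' n).const_mul _]
  simp only [lintegral_const, measure_univ, mul_one, lintegral_const_mul _ (hi _),
    lintegral_const_mul _ (hi' _), lintegral_indicator_one (hm _), lintegral_indicator_one (hm' _)]
  simp only [mul_assoc]
  rw [← Finset.mul_sum]
  calc (L₀ + N : ℝ≥0∞) + (3 * ∑ n ∈ Finset.range T, ((n : ℝ≥0∞) + 1) * P (E n) +
        ∑ n ∈ Finset.range T, ((n : ℝ≥0∞) + 1) * P (E' n))
      ≤ (L₀ + N : ℝ≥0∞) + (3 * ∑' n : ℕ, ((n : ℝ≥0∞) + 1) * P (E n) +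
        ∑' n : ℕ, ((n : ℝ≥0∞) + 1) * P (E' n)) := by
        gcongr <;> exact ENNReal.sum_le_tsum _
    _ = _ := by ring

/-- The arm played beats the index of the leader, which is at least the leader's mean. The first two
leads are excluded: there `log log l` may make the exploration rate negative, leaving no admissible
value in the index. -/
theorem FollowsUBA.empMean_le_index_arm {x : ℕ → Fin K → Bool} {lead arm : ℕ → Fin K}
    (h : FollowsUBA p c A x lead arm) (hp : ∀ k, 0 < p k) (hc : 0 < c) {k : Fin K}
    (hk : k ∈ A k) {t : ℕ} (hlead : lead t = k) (harm : arm t ≠ k) (h2 : 2 ≤ pulls lead k t) :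
    empMean p x arm k t ≤ index p c x lead arm (arm t) t := by
  have hlc : leadCount lead t = pulls lead k t + 1 := by rw [leadCount_eq, hlead]
  have h3 : ¬ (2 + 1) ∣ leadCount lead t - 1 := fun h3 => harm ((h.play_leader t h3).trans hlead)
  refine (empMean_le_index (hp k) (explorationRate_nonneg hc (l := leadCount lead t) (by omega))).trans ?_
  have := (h.play_index t h3).2
  rw [hlead] at this
  exact this k hk

/-- An arm whose energy level is below the mean reward of the leader. -/
theorem IsBernoulliBandit.exists_lintegral_leadPulls_le_of_lt (hX : IsBernoulliBandit P ℱ θ X)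
    (hp : ∀ k, 0 < p k) (hθ : ∀ k, θ k ∈ Set.Icc (0 : ℝ) 1) (hc : 0 < c)
    (harm : ∀ t, Measurable[ℱ t] (arm t))
    (hUBA : ∀ᵐ ω ∂P, FollowsUBA p c A (fun n => X n ω) (fun n => lead n ω) (fun n => arm n ω))
    {k j : Fin K} (hk : k ∈ A k) (hlt : p j < p k * θ k) :
    ∃ C : ℝ≥0, ∀ T : ℕ,
      ∫⁻ ω, (leadPulls (fun n => lead n ω) (fun n => arm n ω) k j T : ℝ≥0∞) ∂P ≤ C := by
  have hd : 0 < p k * θ k - p j := sub_pos.2 hlt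
  obtain ⟨C, hC⟩ := hX.exists_lintegral_leadPulls_le hp hθ harm hUBA k j 2 hd
    (div_sqrt_sqrt_le hd.le) (div_sqrt_sqrt_le hd.le)
  refine ⟨C, fun T => (hC T 0 ?_).trans (by simp)⟩
  filter_upwards [hUBA] with ω h t _ hlead harm'
  by_contra! hcon
  obtain ⟨h2, hdev, -⟩ := hcon
  have hkj : j ≠ k := by
    rintro rfl
    exact absurd hlt (not_lt.2 (mul_le_of_le_one_right (hp j).le (hθ j).2))
  have h1 := h.empMean_le_index_arm hp hc hk hlead (by rw [harm']; exact hkj) h2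
  simp only [harm'] at h1
  have h3 := h1.trans (index_le (hp j))
  exact hdev ⟨t, rfl, by rw [le_abs]; right; linarith⟩

set_option maxHeartbeats 1000000 in
/-- An arm whose energy level is the mean reward of the leader. -/
theorem IsBernoulliBandit.exists_lintegral_leadPulls_le_of_eq (hX : IsBernoulliBandit P ℱ θ X)
    (hp : ∀ k, 0 < p k) (hθ : ∀ k, θ k ∈ Set.Icc (0 : ℝ) 1) (hc : 0 < c)
    (harm : ∀ t, Measurable[ℱ t] (arm t))
    (hUBA : ∀ᵐ ω ∂P, FollowsUBA p c A (fun n => X n ω) (fun n => lead n ω) (fun n => arm n ω))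
    {k j : Fin K} (hk : k ∈ A k) (heq : p k * θ k = p j) (hlt : p j * θ j < p k * θ k) :
    ∃ C : ℝ≥0, ∀ T : ℕ,
      ∫⁻ ω, (leadPulls (fun n => lead n ω) (fun n => arm n ω) k j T : ℝ≥0∞) ∂P ≤ C := by
  have hpj := hp j
  have hθ1 : θ j < 1 := by
    by_contra! h
    rw [heq] at hlt
    nlinarith
  set g : ℝ := (1 - θ j) / 2 with hg
  have hg0 : 0 < g := by rw [hg]; linarith
  have hg1 : g < 1 := by rw [hg]; linarith [(hθ j).1]
  -- `G` makes `g * G` exceed the `log 2` and `log 3` terms of the final comparison, and makes `exp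
  -- (-G) ≤ g`.
  set G : ℝ := Real.log 2 / g + Real.log 3 - Real.log g with hG
  have hlog2 : 0 < Real.log 2 := Real.log_pos (by norm_num)
  have hlog3 : 0 < Real.log 3 := Real.log_pos (by norm_num)
  have hlogg : Real.log g < 0 := Real.log_neg hg0 hg1
  have hexp : Real.exp (-G) ≤ g := by
    rw [← Real.le_log_iff_exp_le hg0, hG]
    have : 0 < Real.log 2 / g := by positivity
    linarith
  set d : ℝ := p j * Real.exp (-G) with hd
  have hd0 : 0 < d := by positivity
  obtain ⟨C, hC⟩ := hX.exists_lintegral_leadPulls_le hp hθ harm hUBA k j 2 hd0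
    (r := fun n => d / √(√((n : ℝ) + 1))) (r' := fun _ => p j * g) (fun n => le_rfl)
    (fun n => (div_sqrt_sqrt_le hd0.le n).trans (by rw [hd]; gcongr))
  -- After `N` plays of `j` the exploration term is at most `g / 4 * log l`. The radius of order `n
  -- ^ (-1 / 4)` forces a divergence of at least `g * (G + log (n + 1) / 4) - log 2`, so the terms
  -- in `log (n + 1)` cancel and the constants contradict each other.
  obtain ⟨N, hN⟩ := exists_nat_gt ((1 + c) * 4 / g)
  refine ⟨N + C, fun T => (hC T N ?_).trans (by simp)⟩
  filter_upwards [hUBA] with ω h t _ hlead harm'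
  by_contra! hcon
  obtain ⟨h2, hdev, hdev', hNle⟩ := hcon
  set n := pulls (fun n => arm n ω) k t with hn
  set u : ℝ := √(√((n : ℝ) + 1)) with hu
  have hn1 : (0 : ℝ) < (n : ℝ) + 1 := by positivity
  have hu0 : 0 < u := Real.sqrt_pos.2 (Real.sqrt_pos.2 hn1)
  have hN0 : (0 : ℝ) < N := lt_trans (by positivity) hN
  have hNle' : (N : ℝ) ≤ pulls (fun n => arm n ω) j t := by exact_mod_cast hNle
  have hkj : j ≠ k := by
    rintro rfl
    exact lt_irrefl _ hlt
  have hidx := h.empMean_le_index_arm hp hc hk hlead (by rw [harm']; exact hkj) h2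
  simp only [harm'] at hidx
  have hlc : leadCount (fun n => lead n ω) t = pulls (fun n => lead n ω) k t + 1 := by
    rw [leadCount_eq, hlead]
  set l := leadCount (fun n => lead n ω) t with hl
  have hl3 : 3 ≤ l := by omega
  have hrate := explorationRate_nonneg hc hl3
  have h1 : |empMean p (fun n => X n ω) (fun n => arm n ω) k t - p k * θ k| < d / u := by
    by_contra! hcon
    exact hdev ⟨t, rfl, hcon⟩
  have h1' : |empMean p (fun n => X n ω) (fun n => arm n ω) j t - p j * θ j| < p j * g := by
    by_contra! hcon
    exact hdev' ⟨t, rfl, hcon⟩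
  rw [abs_lt] at h1 h1'
  have hv : p j - d / u < index p c (fun n => X n ω) (fun n => lead n ω) (fun n => arm n ω) j t := by
    rw [← heq]
    linarith
  have hpos : pulls (fun n => arm n ω) j t ≠ 0 := by
    intro h0
    rw [h0, Nat.cast_zero] at hNle'
    linarith
  obtain ⟨q, hvq, hqp, hkl⟩ := exists_of_lt_index hpj hrate hpos hv
  set y : ℝ := q / p j with hy
  have hy1 : y ≤ 1 := (div_le_one hpj).2 hqp
  have hylow : 1 - Real.exp (-G) / u < y := by
    rw [hy, lt_div_iff₀ hpj]
    refine lt_of_eq_of_lt ?_ hvq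
    rw [hd]
    ring
  have hz : 1 - g < y := by
    have : Real.exp (-G) / u ≤ Real.exp (-G) := div_sqrt_sqrt_le (Real.exp_pos _).le n
    linarith
  -- Since `g` is half of `1 - θ j`, the number `1 - g` equals `θ j + g`.
  have hxz : empMean p (fun n => X n ω) (fun n => arm n ω) j t / p j ≤ 1 - g := by
    rw [div_le_iff₀ hpj]
    have : (1 - g) * p j = p j * θ j + p j * g := by rw [hg]; ring
    linarith
  have hkl2 := (bernoulliKL_anti_left (empMean_div_mem hpj t).1 hxz hz.le hy1).trans hkl
  have hylt : y < 1 := by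
    refine lt_of_le_of_ne hy1 fun h0 => ?_
    rw [h0, bernoulliKL_one_right (by linarith), top_le_iff] at hkl2
    exact ENNReal.ofReal_ne_top hkl2
  have hyI : y ∈ Set.Ioo (0 : ℝ) 1 := ⟨by linarith, hylt⟩
  rw [bernoulliKL_of_mem_Ioo hyI, ENNReal.ofReal_le_ofReal_iff
    (div_nonneg hrate (Nat.cast_nonneg _))] at hkl2
  have h4 := (realKL_ge_log ⟨by linarith, by linarith⟩ hyI).trans hkl2
  rw [sub_sub_cancel] at h4
  have h5 : Real.log (1 - y) < -G - Real.log ((n : ℝ) + 1) / 4 := by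
    have e : Real.log (Real.exp (-G) / u) = -G - Real.log ((n : ℝ) + 1) / 4 := by
      rw [Real.log_div (Real.exp_pos _).ne' hu0.ne', Real.log_exp, hu,
        Real.log_sqrt (Real.sqrt_nonneg _), Real.log_sqrt hn1.le]
      ring
    rw [← e]
    exact Real.log_lt_log (by linarith) (by linarith)
  have h6 : explorationRate c l / (pulls (fun n => arm n ω) j t : ℝ) ≤
      g / 4 * (Real.log 3 + Real.log ((n : ℝ) + 1)) := by
    have hl' : (l : ℝ) ≤ 3 * ((n : ℝ) + 1) := by
      have := h.pulls_le_three_mul k t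
      have h7 : l ≤ 3 * (n + 1) := by omega
      exact_mod_cast h7
    have hlogl : Real.log l ≤ Real.log 3 + Real.log ((n : ℝ) + 1) := by
      rw [← Real.log_mul (by norm_num) hn1.ne']
      exact Real.log_le_log (by have : 0 < l := by omega
                                exact_mod_cast this) hl'
    have hlog1 := one_le_log_of_three_le hl3
    calc explorationRate c l / (pulls (fun n => arm n ω) j t : ℝ)
        ≤ (1 + c) * Real.log l / N :=
          div_le_div₀ (by positivity) (explorationRate_le_mul_log hc hl3) hN0 hNle'
      _ ≤ g / 4 * Real.log l := by
          rw [div_le_iff₀ hN0]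
          rw [div_lt_iff₀ hg0] at hN
          nlinarith
      _ ≤ _ := by gcongr
  have h7 : g * G = Real.log 2 + g * Real.log 3 - g * Real.log g := by
    rw [hG]
    field_simp
  have h8 : g * (G + Real.log ((n : ℝ) + 1) / 4) < g * -Real.log (1 - y) :=
    mul_lt_mul_of_pos_left (by linarith) hg0
  nlinarith [mul_pos hg0 hlog3, mul_pos hg0 (neg_pos.2 hlogg)]

/-- An arm whose energy level exceeds the mean reward of the leader. -/
theorem IsBernoulliBandit.exists_lintegral_leadPulls_le_log (hX : IsBernoulliBandit P ℱ θ X)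
    (hp : ∀ k, 0 < p k) (hθ : ∀ k, θ k ∈ Set.Icc (0 : ℝ) 1) (hc : 0 < c)
    (harm : ∀ t, Measurable[ℱ t] (arm t))
    (hUBA : ∀ᵐ ω ∂P, FollowsUBA p c A (fun n => X n ω) (fun n => lead n ω) (fun n => arm n ω))
    {k j : Fin K} (hk : k ∈ A k) (hpj : p k * θ k < p j) (hlt : p j * θ j < p k * θ k)
    {ε : ℝ} (hε : 0 < ε) :
    ∃ C : ℝ≥0, ∀ T : ℕ,
      ∫⁻ ω, (leadPulls (fun n => lead n ω) (fun n => arm n ω) k j T : ℝ≥0∞) ∂P ≤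
        ENNReal.ofReal ((1 + ε) * Real.log T / realKL (θ j) (p k * θ k / p j)) + C := by
  have hpj0 := hp j
  set y₀ : ℝ := p k * θ k / p j with hy₀
  have hy₀1 : y₀ < 1 := (div_lt_one hpj0).2 hpj
  have hθy : θ j < y₀ := by
    rw [hy₀, lt_div_iff₀ hpj0, mul_comm]
    exact hlt
  -- One factor `1 + η` absorbs the double logarithm, the other the loss from moving both arguments
  -- of the divergence by `d`.
  obtain ⟨η, hη, hηε⟩ : ∃ η > 0, (1 + η) * (1 + η) = 1 + ε := by
    refine ⟨√(1 + ε) - 1, ?_, ?_⟩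
    · rw [gt_iff_lt, sub_pos, Real.lt_sqrt (by norm_num)]
      linarith
    · rw [add_sub_cancel]
      exact Real.mul_self_sqrt (by linarith)
  obtain ⟨d, hd0, hdlt, hI₁, hI⟩ := exists_realKL_le_mul_shift (hθ j).1 hθy hy₀1 hη
  set I₁ : ℝ := realKL (θ j + d) (y₀ - d) with hI₁def
  set I₀ : ℝ := realKL (θ j) y₀ with hI₀def
  have hI₀ : 0 < I₀ := by
    have h := sq_sub_le_realKL (hθ j) ⟨(hθ j).1.trans_lt hθy, hy₀1⟩
    have h0 : θ j - y₀ ≠ 0 := by linarith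
    exact lt_of_lt_of_le (by positivity) h
  have hr0 : 0 < p j * d := by positivity
  obtain ⟨C, hC⟩ := hX.exists_lintegral_leadPulls_le hp hθ harm hUBA k j 2 hr0
    (div_sqrt_sqrt_le hr0.le) (div_sqrt_sqrt_le hr0.le)
  set C₁ : ℝ := |c * Real.log (c / η)| with hC₁
  refine ⟨(C₁ / I₁ + 1).toNNReal + C, fun T => ?_⟩
  set B : ℝ := ((1 + η) * Real.log T + C₁) / I₁ with hB
  have hlogT : 0 ≤ Real.log T := Real.log_natCast_nonneg T
  have hB0 : 0 ≤ B := by positivity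
  refine (hC T (⌊B⌋₊ + 1) ?_).trans ?_
  -- With both means accurate and the index of `j` at least the mean of `k`, monotonicity of the
  -- divergence in both arguments gives `I₁ ≤ explorationRate / plays`, hence at most `B` plays of
  -- `j` so far.
  · filter_upwards [hUBA] with ω h t htT hlead harm'
    by_contra! hcon
    obtain ⟨h2, hdev, hdev', hNle⟩ := hcon
    have hkj : j ≠ k := by
      rintro rfl
      exact lt_irrefl _ hlt
    have hidx := h.empMean_le_index_arm hp hc hk hlead (by rw [harm']; exact hkj) h2
    simp only [harm'] at hidx
    have hlc : leadCount (fun n => lead n ω) t = pulls (fun n => lead n ω) k t + 1 := by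
      rw [leadCount_eq, hlead]
    set l := leadCount (fun n => lead n ω) t with hl
    have hl3 : 3 ≤ l := by omega
    have hlT : l ≤ T := by
      have := pulls_le (fun n => lead n ω) k t
      omega
    have hrate := explorationRate_nonneg hc hl3
    have h1 : |empMean p (fun n => X n ω) (fun n => arm n ω) k t - p k * θ k| < p j * d := by
      by_contra! hcon
      exact hdev ⟨t, rfl, hcon⟩
    have h1' : |empMean p (fun n => X n ω) (fun n => arm n ω) j t - p j * θ j| < p j * d := by
      by_contra! hcon
      exact hdev' ⟨t, rfl, hcon⟩
    rw [abs_lt] at h1 h1'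
    have hv : p k * θ k - p j * d <
        index p c (fun n => X n ω) (fun n => lead n ω) (fun n => arm n ω) j t := by linarith
    have hpos : pulls (fun n => arm n ω) j t ≠ 0 := by omega
    obtain ⟨q, hvq, hqp, hkl⟩ := exists_of_lt_index hpj0 hrate hpos hv
    have hxz : empMean p (fun n => X n ω) (fun n => arm n ω) j t / p j ≤ θ j + d := by
      rw [div_le_iff₀ hpj0]
      linarith
    have hyq : y₀ - d ≤ q / p j := by
      rw [le_div_iff₀ hpj0, sub_mul, hy₀, div_mul_cancel₀ _ hpj0.ne']
      linarith
    have hzI : y₀ - d ∈ Set.Ioo (0 : ℝ) 1 := ⟨by linarith [(hθ j).1], by linarith⟩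
    have hz0 : 0 ≤ θ j + d := by linarith [(hθ j).1]
    have hq1 : q / p j ≤ 1 := (div_le_one hpj0).2 hqp
    have hkl2 := ((bernoulliKL_mono_right hz0 hdlt.le hyq hq1).trans
      (bernoulliKL_anti_left (empMean_div_mem hpj0 t).1 hxz (hdlt.le.trans hyq) hq1)).trans hkl
    have hn0 : (0 : ℝ) < pulls (fun n => arm n ω) j t := by
      exact_mod_cast Nat.pos_of_ne_zero hpos
    rw [bernoulliKL_of_mem_Ioo hzI, ENNReal.ofReal_le_ofReal_iff (by positivity),
      le_div_iff₀ hn0] at hkl2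
    have h3 : (pulls (fun n => arm n ω) j t : ℝ) ≤ B := by
      rw [hB, le_div_iff₀ hI₁]
      have h4 := explorationRate_le hc hη hl3
      have h5 : Real.log l ≤ Real.log T :=
        Real.log_le_log (by have : 0 < l := by omega
                            exact_mod_cast this) (by exact_mod_cast hlT)
      have h6 : c * Real.log (c / η) ≤ C₁ := le_abs_self _
      nlinarith
    have h4 : (⌊B⌋₊ + 1 : ℝ) ≤ pulls (fun n => arm n ω) j t := by exact_mod_cast hNle
    linarith [Nat.lt_floor_add_one B]
  · rw [ENNReal.coe_add, ← add_assoc]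
    gcongr
    have hC₁0 : 0 ≤ C₁ := abs_nonneg _
    change _ ≤ _ + ENNReal.ofReal (C₁ / I₁ + 1)
    rw [← ENNReal.ofReal_add (by positivity) (by positivity), ← ENNReal.ofReal_natCast]
    refine ENNReal.ofReal_le_ofReal ?_
    push_cast
    have h1 : ((1 + η) * Real.log T) / I₁ ≤ (1 + ε) * Real.log T / I₀ := by
      rw [div_le_div_iff₀ hI₁ hI₀, ← hηε]
      calc (1 + η) * Real.log T * I₀ ≤ (1 + η) * Real.log T * ((1 + η) * I₁) := by gcongr
        _ = _ := by ring
    have h2 := Nat.floor_le hB0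
    rw [hB, add_div] at h2
    rw [hB, add_div]
    linarith

end Plays

/-! ### Unimodality and the regret bound -/

section Regret

/-- A maximal arm is the peak of a unimodal instance: the mean rewards increase towards it. -/
theorem unimodal_peak {K : ℕ} {p θ : Fin K → ℝ} (h : θ ∈ unimodalClass p) {kstar : Fin K}
    (hk : ∀ k, p k * θ k ≤ p kstar * θ kstar) :
    StrictMonoOn (fun k => p k * θ k) (Set.Iic kstar) ∧
      StrictAntiOn (fun k => p k * θ k) (Set.Ici kstar) := by
  obtain ⟨-, m, h1, h2⟩ := h
  have : kstar = m := by
    rcases lt_trichotomy kstar m with hlt | heq | hgt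
    · exact absurd (h1 hlt.le (Set.mem_Iic.2 le_rfl) hlt) (not_lt.2 (hk m))
    · exact heq
    · exact absurd (h2 (Set.mem_Ici.2 le_rfl) hgt.le hgt) (not_lt.2 (hk m))
  rw [this]
  exact ⟨h1, h2⟩

theorem lt_peak {K : ℕ} {p θ : Fin K → ℝ} (h : θ ∈ unimodalClass p) {kstar : Fin K}
    (hk : ∀ k, p k * θ k ≤ p kstar * θ kstar) {k : Fin K} (hne : k ≠ kstar) :
    p k * θ k < p kstar * θ kstar := by
  obtain ⟨h1, h2⟩ := unimodal_peak h hk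
  rcases hne.lt_or_gt with hlt | hgt
  · exact h1 hlt.le (Set.mem_Iic.2 le_rfl) hlt
  · exact h2 (Set.mem_Ici.2 le_rfl) hgt.le hgt

/-- Every arm other than the peak has a strictly better neighbour. -/
theorem exists_better_neighbour {K : ℕ} {p θ : Fin K → ℝ} (hp : ∀ k, 0 < p k)
    (h : θ ∈ unimodalClass p) {kstar : Fin K}
    (hk : ∀ k, p k * θ k ≤ p kstar * θ kstar) {k : Fin K} (hne : k ≠ kstar) :
    ∃ j ∈ neighbours p θ k, p k * θ k < p j * θ j := by
  obtain ⟨h1, h2⟩ := unimodal_peak h hk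
  have hle : ∀ j, p j * θ j ≤ p j := fun j => mul_le_of_le_one_right (hp j).le (h.1 j).2
  -- A better adjacent arm always belongs to `neighbours`, as its energy level dominates its mean
  -- reward.
  have hmem : ∀ j, Adjacent j k → p k * θ k < p j * θ j → j ∈ neighbours p θ k := fun j hj hlt => by
    simp only [neighbours, Finset.mem_filter, Finset.mem_univ, true_and]
    exact ⟨hj, hlt.le.trans (hle j)⟩
  rcases hne.lt_or_gt with hlt | hgt
  · have hlt' := Fin.lt_def.1 hlt
    set j : Fin K := ⟨k.val + 1, lt_of_le_of_lt hlt' kstar.isLt⟩ with hj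
    have hjlt : p k * θ k < p j * θ j :=
      h1 hlt.le (Fin.le_def.2 hlt') (Fin.lt_def.2 (Nat.lt_succ_self _))
    exact ⟨j, hmem j (Or.inr rfl) hjlt, hjlt⟩
  · have hgt' := Fin.lt_def.1 hgt
    set j : Fin K := ⟨k.val - 1, by omega⟩ with hj
    have hjlt : p k * θ k < p j * θ j :=
      h2 (Fin.le_def.2 (by simp only [hj]; omega)) hgt.le
        (Fin.lt_def.2 (by simp only [hj]; omega))
    exact ⟨j, hmem j (Or.inl (by simp only [hj]; omega)) hjlt, hjlt⟩

theorem pulls_le_sum_add_leadPulls {K : ℕ} (lead arm : ℕ → Fin K) (k j : Fin K) (T : ℕ) :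
    pulls arm j T ≤ ∑ i ∈ Finset.univ.erase k, pulls lead i T + leadPulls lead arm k j T := by
  have hsub : (Finset.range T).filter (fun t => arm t = j) ⊆
      ((Finset.univ.erase k).biUnion fun i => (Finset.range T).filter fun t => lead t = i) ∪
        (Finset.range T).filter fun t => lead t = k ∧ arm t = j := by
    intro t ht
    simp only [Finset.mem_filter, Finset.mem_union, Finset.mem_biUnion, Finset.mem_erase,
      Finset.mem_univ, and_true] at ht ⊢
    by_cases h : lead t = k
    · exact Or.inr ⟨ht.1, h, ht.2⟩
    · exact Or.inl ⟨lead t, h, ht.1, rfl⟩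
  exact (Finset.card_le_card hsub).trans ((Finset.card_union_le _ _).trans
    (Nat.add_le_add_right Finset.card_biUnion_le _))

variable {Ω : Type*} {m : MeasurableSpace Ω} {K : ℕ} {P : Measure Ω} [IsProbabilityMeasure P]
  {ℱ : Filtration ℕ m} {p θ : Fin K → ℝ} {c : ℝ} {A : Fin K → Finset (Fin K)}
  {X : ℕ → Ω → Fin K → Bool} {lead arm : ℕ → Ω → Fin K}

/-- The regret is the sum of the gaps times the expected numbers of plays. -/
theorem ofReal_regret_le (kstar : Fin K) (hkstar : ∀ k, p k * θ k ≤ p kstar * θ kstar)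
    (harm : ∀ t, Measurable (arm t)) (T : ℕ) :
    ENNReal.ofReal (regret P p θ kstar arm T) ≤
      ∑ k, ENNReal.ofReal (p kstar * θ kstar - p k * θ k) *
        ∫⁻ ω, (pulls (fun n => arm n ω) k T : ℝ≥0∞) ∂P := by
  have hmeas : ∀ k, Measurable fun ω => pulls (fun n => arm n ω) k T := fun k =>
    measurable_pulls fun n _ => harm n
  have hint : ∀ k, Integrable (fun ω => (pulls (fun n => arm n ω) k T : ℝ)) P := fun k => by
    refine Integrable.of_bound (C := T)
      (measurable_from_top.comp (hmeas k)).aestronglyMeasurable (ae_of_all _ fun ω => ?_)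
    rw [Real.norm_of_nonneg (Nat.cast_nonneg _)]
    exact_mod_cast pulls_le _ k T
  have hsum : ∑ k, ∫ ω, (pulls (fun n => arm n ω) k T : ℝ) ∂P = T := by
    rw [← integral_finsetSum _ fun k _ => hint k]
    have : ∀ ω, ∑ k, (pulls (fun n => arm n ω) k T : ℝ) = T := fun ω => by
      exact_mod_cast sum_pulls (fun n => arm n ω) T
    simp [this]
  have hreg : regret P p θ kstar arm T = ∑ k, (p kstar * θ kstar - p k * θ k) *
      ∫ ω, (pulls (fun n => arm n ω) k T : ℝ) ∂P := by
    unfold regret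
    rw [← hsum, Finset.mul_sum, ← Finset.sum_sub_distrib]
    exact Finset.sum_congr rfl fun k _ => by ring
  rw [hreg, ENNReal.ofReal_sum_of_nonneg fun k _ =>
    mul_nonneg (sub_nonneg.2 (hkstar k)) (integral_nonneg fun ω => Nat.cast_nonneg _)]
  refine Finset.sum_le_sum fun k _ => ?_
  rw [ENNReal.ofReal_mul (sub_nonneg.2 (hkstar k)),
    ofReal_integral_eq_lintegral_ofReal (hint k) (ae_of_all _ fun ω => Nat.cast_nonneg _)]
  simp only [ENNReal.ofReal_natCast, le_refl]

/-- The expected number of plays of a suboptimal arm, up to a bounded term: logarithmic for the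
neighbours of the best arm and zero for all others. -/
theorem IsBernoulliBandit.exists_lintegral_pulls_le (hX : IsBernoulliBandit P ℱ θ X)
    (hp : ∀ k, 0 < p k) (hu : θ ∈ unimodalClass p) {kstar : Fin K}
    (hkstar : ∀ k, p k * θ k ≤ p kstar * θ kstar) (hc : 0 < c) (hA_self : ∀ k, k ∈ A k)
    (hA_nbr : ∀ k, neighbours p θ k ⊆ A k)
    (hA_adj : ∀ k, ∀ j ∈ A k, j = k ∨ Adjacent j k)
    (hlead : ∀ t, Measurable[ℱ t] (lead t)) (harm : ∀ t, Measurable[ℱ t] (arm t))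
    (hUBA : ∀ᵐ ω ∂P, FollowsUBA p c A (fun n => X n ω) (fun n => lead n ω) (fun n => arm n ω))
    {ε : ℝ} (hε : 0 < ε) {k : Fin K} (hk : k ≠ kstar) :
    ∃ C : ℝ≥0, ∀ T : ℕ, ∫⁻ ω, (pulls (fun n => arm n ω) k T : ℝ≥0∞) ∂P ≤
      (if k ∈ neighbours p θ kstar then
        ENNReal.ofReal ((1 + ε) * Real.log T) / bernoulliKL (θ k) (p kstar * θ kstar / p k)
        else 0) + C := by
  have hθ := hu.1
  have hlt := lt_peak hu hkstar hk
  have hL : ∀ i : Fin K, ∃ C : ℝ≥0, i ≠ kstar → ∀ T : ℕ,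
      ∫⁻ ω, (pulls (fun n => lead n ω) i T : ℝ≥0∞) ∂P ≤ C := by
    intro i
    by_cases hi : i = kstar
    · exact ⟨0, fun h => absurd hi h⟩
    · obtain ⟨j, hj, hij⟩ := exists_better_neighbour hp hu hkstar hi
      obtain ⟨C, hC⟩ := hX.exists_lintegral_pulls_lead_le hp hθ hc hlead harm hUBA
        (hA_nbr i hj) hij
      exact ⟨C, fun _ => hC⟩
  choose CL hCL using hL
  have hplay : ∃ C : ℝ≥0, ∀ T : ℕ,
      ∫⁻ ω, (leadPulls (fun n => lead n ω) (fun n => arm n ω) kstar k T : ℝ≥0∞) ∂P ≤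
      (if k ∈ neighbours p θ kstar then
        ENNReal.ofReal ((1 + ε) * Real.log T) / bernoulliKL (θ k) (p kstar * θ kstar / p k)
        else 0) + C := by
    by_cases hkN : k ∈ neighbours p θ kstar
    · simp only [if_pos hkN]
      have hle : p kstar * θ kstar ≤ p k := by
        simp only [neighbours, Finset.mem_filter] at hkN
        exact hkN.2.2
      -- In the case of equality the second argument of the divergence is 1, the divergence is
      -- infinite and the logarithmic term vanishes; the plays must be bounded outright.
      rcases hle.eq_or_lt with heq | hlt'
      · obtain ⟨C, hC⟩ := hX.exists_lintegral_leadPulls_le_of_eq hp hθ hc harm hUBA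
          (hA_self kstar) heq hlt
        exact ⟨C, fun T => (hC T).trans le_add_self⟩
      · obtain ⟨C, hC⟩ := hX.exists_lintegral_leadPulls_le_log hp hθ hc harm hUBA
          (hA_self kstar) hlt' hlt hε
        refine ⟨C, fun T => (hC T).trans (le_of_eq ?_)⟩
        have hy : θ k < p kstar * θ kstar / p k := by
          rw [lt_div_iff₀ (hp k), mul_comm]
          exact hlt
        have hyI : p kstar * θ kstar / p k ∈ Set.Ioo (0 : ℝ) 1 :=
          ⟨(hθ k).1.trans_lt hy, (div_lt_one (hp k)).2 hlt'⟩
        have hI : 0 < realKL (θ k) (p kstar * θ kstar / p k) := by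
          have h0 : θ k - p kstar * θ kstar / p k ≠ 0 := by linarith
          exact lt_of_lt_of_le (by positivity) (sq_sub_le_realKL (hθ k) hyI)
        rw [bernoulliKL_of_mem_Ioo hyI, ENNReal.ofReal_div_of_pos hI]
    · simp only [if_neg hkN, zero_add]
      by_cases hadj : Adjacent k kstar
      · refine hX.exists_lintegral_leadPulls_le_of_lt hp hθ hc harm hUBA (hA_self kstar) ?_
        by_contra! hle
        exact hkN (by
          simp only [neighbours, Finset.mem_filter, Finset.mem_univ, true_and]
          exact ⟨hadj, hle⟩)
      · refine ⟨0, fun T => le_of_eq ?_⟩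
        rw [ENNReal.coe_zero]
        refine lintegral_eq_zero_of_ae_eq_zero ?_
        filter_upwards [hUBA] with ω h
        rw [Pi.zero_apply, Nat.cast_eq_zero, leadPulls, Finset.card_eq_zero,
          Finset.filter_eq_empty_iff]
        rintro t - ⟨hl, ha⟩
        by_cases h3 : (2 + 1) ∣ leadCount (fun n => lead n ω) t - 1
        · exact hk (ha ▸ (h.play_leader t h3).trans hl)
        · have := (h.play_index t h3).1
          simp only [hl, ha] at this
          exact (hA_adj kstar k this).elim hk hadj
  obtain ⟨C, hC⟩ := hplay
  refine ⟨∑ i ∈ Finset.univ.erase kstar, CL i + C, fun T => ?_⟩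
  have hm : ∀ i, Measurable fun ω => (pulls (fun n => lead n ω) i T : ℝ≥0∞) := fun i =>
    measurable_from_top.comp (measurable_pulls fun n _ => (hlead n).mono (ℱ.le n) le_rfl)
  calc ∫⁻ ω, (pulls (fun n => arm n ω) k T : ℝ≥0∞) ∂P
      ≤ ∫⁻ ω, (∑ i ∈ Finset.univ.erase kstar, (pulls (fun n => lead n ω) i T : ℝ≥0∞) +
          (leadPulls (fun n => lead n ω) (fun n => arm n ω) kstar k T : ℝ≥0∞)) ∂P := by
        refine lintegral_mono fun ω => ?_
        rw [← Nat.cast_sum, ← Nat.cast_add]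
        exact Nat.cast_le.2 (pulls_le_sum_add_leadPulls (fun n => lead n ω) (fun n => arm n ω) kstar k T)
    _ = ∑ i ∈ Finset.univ.erase kstar, ∫⁻ ω, (pulls (fun n => lead n ω) i T : ℝ≥0∞) ∂P +
          ∫⁻ ω, (leadPulls (fun n => lead n ω) (fun n => arm n ω) kstar k T : ℝ≥0∞) ∂P := by
        rw [lintegral_add_left (Finset.measurable_sum _ fun i _ => hm i),
          lintegral_finsetSum _ fun i _ => hm i]
    _ ≤ ∑ i ∈ Finset.univ.erase kstar, (CL i : ℝ≥0∞) + _ := by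
        refine add_le_add (Finset.sum_le_sum fun i hi => ?_) (hC T)
        exact hCL i (Finset.ne_of_mem_erase hi) T
    _ = _ := by
        push_cast
        rw [add_left_comm]

/-- The regret bound for arbitrary energy levels. -/
theorem IsBernoulliBandit.exists_regret_le (hX : IsBernoulliBandit P ℱ θ X)
    (hp : ∀ k, 0 < p k) (hu : θ ∈ unimodalClass p) {kstar : Fin K}
    (hkstar : ∀ k, p k * θ k ≤ p kstar * θ kstar) (hc : 0 < c) (hA_self : ∀ k, k ∈ A k)
    (hA_nbr : ∀ k, neighbours p θ k ⊆ A k)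
    (hA_adj : ∀ k, ∀ j ∈ A k, j = k ∨ Adjacent j k)
    (hlead : ∀ t, Measurable[ℱ t] (lead t)) (harm : ∀ t, Measurable[ℱ t] (arm t))
    (hUBA : ∀ᵐ ω ∂P, FollowsUBA p c A (fun n => X n ω) (fun n => lead n ω) (fun n => arm n ω))
    {ε : ℝ} (hε : 0 < ε) :
    ∃ C : ℝ≥0, ∀ T : ℕ, ENNReal.ofReal (regret P p θ kstar arm T) ≤
      ENNReal.ofReal (1 + ε) * (∑ k ∈ neighbours p θ kstar,
        ENNReal.ofReal (p kstar * θ kstar - p k * θ k) /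
          bernoulliKL (θ k) (p kstar * θ kstar / p k)) * ENNReal.ofReal (Real.log T) + C := by
  have h : ∀ k : Fin K, ∃ C : ℝ≥0, ∀ T : ℕ, ENNReal.ofReal (p kstar * θ kstar - p k * θ k) *
      ∫⁻ ω, (pulls (fun n => arm n ω) k T : ℝ≥0∞) ∂P ≤
      (if k ∈ neighbours p θ kstar then ENNReal.ofReal (1 + ε) *
        (ENNReal.ofReal (p kstar * θ kstar - p k * θ k) /
          bernoulliKL (θ k) (p kstar * θ kstar / p k)) * ENNReal.ofReal (Real.log T) else 0) +
        C := by
    intro k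
    by_cases hk : k = kstar
    · exact ⟨0, fun T => by simp [hk]⟩
    · obtain ⟨C, hC⟩ := hX.exists_lintegral_pulls_le hp hu hkstar hc hA_self hA_nbr hA_adj hlead
        harm hUBA hε hk
      refine ⟨(p kstar * θ kstar - p k * θ k).toNNReal * C, fun T =>
        (mul_le_mul_right (hC T) _).trans (le_of_eq ?_)⟩
      rw [mul_add, ENNReal.coe_mul]
      congr 1
      split_ifs
      · rw [ENNReal.ofReal_mul (by linarith)]
        simp only [div_eq_mul_inv]
        ring
      · exact mul_zero _
  choose C hC using h
  refine ⟨∑ k, C k, fun T => (ofReal_regret_le kstar hkstar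
    (fun t => (harm t).mono (ℱ.le t) le_rfl) T).trans
    ((Finset.sum_le_sum fun k _ => hC k T).trans (le_of_eq ?_))⟩
  rw [Finset.sum_add_distrib, Finset.sum_ite_mem, Finset.univ_inter, Finset.mul_sum,
    Finset.sum_mul, ENNReal.ofNNReal_finsetSum]

/-- With non-increasing energy levels the mean reward of the best arm may be replaced by its
success probability. -/
theorem bernoulliKL_le_of_antitone {p θ : Fin K → ℝ} (hp : ∀ k, 0 < p k)
    (hθ : θ ∈ monotoneClass K ∩ unimodalClass p) {kstar k : Fin K}
    (hkstar : ∀ k, p k * θ k ≤ p kstar * θ kstar) (hanti : Antitone p)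
    (hk : k ∈ neighbours p θ kstar) :
    bernoulliKL (θ k) (θ kstar) ≤ bernoulliKL (θ k) (p kstar * θ kstar / p k) := by
  obtain ⟨⟨h01, hmono⟩, hu⟩ := hθ
  simp only [neighbours, Finset.mem_filter, Finset.mem_univ, true_and] at hk
  obtain ⟨hadj, hle⟩ := hk
  have hne : k ≠ kstar := by
    rintro rfl
    unfold Adjacent at hadj
    omega
  have hlt := lt_peak hu hkstar hne
  -- If `k` came before `kstar`, both `p` and `θ` would be at least as large at `k`, and so would
  -- the mean reward.
  have hgt : kstar ≤ k := by
    by_contra! h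
    have := mul_le_mul (hanti h.le) (hmono h.le) (h01 kstar).1 (hp k).le
    linarith
  refine bernoulliKL_mono_right (h01 k).1 (hmono hgt) ?_ ((div_le_one (hp k)).2 hle)
  rw [le_div_iff₀ (hp k), mul_comm]
  exact mul_le_mul_of_nonneg_right (hanti hgt) (h01 kstar).1

end Regret

end BeamAlignment

theorem theorem2 {K : ℕ} (p θ : Fin K → ℝ) (hp : ∀ k, 0 < p k)
    (hθ : θ ∈ BeamAlignment.monotoneClass K ∩ BeamAlignment.unimodalClass p)
    (kstar : Fin K) (hkstar : ∀ k, p k * θ k ≤ p kstar * θ kstar)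
    (c : ℝ) (hc : 0 < c)
    -- the arms that may be played while `k` leads: any set between `N(k) ∪ {k}` and
    -- `{k - 1, k, k + 1}`
    (A : Fin K → Finset (Fin K))
    (hA_self : ∀ k, k ∈ A k)
    (hA_nbr : ∀ k, BeamAlignment.neighbours p θ k ⊆ A k)
    (hA_adj : ∀ k, ∀ j ∈ A k, j = k ∨ BeamAlignment.Adjacent j k)
    {Ω : Type*} {m : MeasurableSpace Ω} (P : Measure Ω) [IsProbabilityMeasure P]
    (ℱ : Filtration ℕ m) (X : ℕ → Ω → Fin K → Bool)
    (hX : BeamAlignment.IsBernoulliBandit P ℱ θ X)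
    (lead arm : ℕ → Ω → Fin K)
    (hlead : ∀ t, Measurable[ℱ t] (lead t)) (harm : ∀ t, Measurable[ℱ t] (arm t))
    (hUBA : ∀ᵐ ω ∂P, BeamAlignment.FollowsUBA p c A (fun n => X n ω)
      (fun n => lead n ω) (fun n => arm n ω)) :
    -- energy levels non-increasing in the misalignment: the bound with `I(θ_k, θ_{k*})`
    (Antitone p → ∀ ε : ℝ, 0 < ε → ∃ C : ℝ≥0, ∀ T : ℕ,
      ENNReal.ofReal (BeamAlignment.regret P p θ kstar arm T) ≤
        ENNReal.ofReal (1 + ε) *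
          (∑ k ∈ BeamAlignment.neighbours p θ kstar,
            ENNReal.ofReal (p kstar * θ kstar - p k * θ k) /
              BeamAlignment.bernoulliKL (θ k) (θ kstar)) *
          ENNReal.ofReal (Real.log T) + C) ∧
    -- arbitrary energy levels: the bound with `I(θ_k, p_{k*} θ_{k*} / p_k)`
    (∀ ε : ℝ, 0 < ε → ∃ C : ℝ≥0, ∀ T : ℕ,
      ENNReal.ofReal (BeamAlignment.regret P p θ kstar arm T) ≤
        ENNReal.ofReal (1 + ε) *
          (∑ k ∈ BeamAlignment.neighbours p θ kstar,
            ENNReal.ofReal (p kstar * θ kstar - p k * θ k) /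
              BeamAlignment.bernoulliKL (θ k) (p kstar * θ kstar / p k)) *
          ENNReal.ofReal (Real.log T) + C) := by
  have hmain : ∀ ε : ℝ, 0 < ε → ∃ C : ℝ≥0, ∀ T : ℕ,
      ENNReal.ofReal (BeamAlignment.regret P p θ kstar arm T) ≤
        ENNReal.ofReal (1 + ε) *
          (∑ k ∈ BeamAlignment.neighbours p θ kstar,
            ENNReal.ofReal (p kstar * θ kstar - p k * θ k) /
              BeamAlignment.bernoulliKL (θ k) (p kstar * θ kstar / p k)) *
          ENNReal.ofReal (Real.log T) + C :=
    fun ε hε => hX.exists_regret_le hp hθ.2 hkstar hc hA_self hA_nbr hA_adj hlead harm hUBA hε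
  refine ⟨fun hanti ε hε => ?_, hmain⟩
  obtain ⟨C, hC⟩ := hmain ε hε
  refine ⟨C, fun T => (hC T).trans ?_⟩
  gcongr with k hk
  exact BeamAlignment.bernoulliKL_le_of_antitone hp hθ hkstar hanti hk
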